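/- Let $(R,\mathfrak m,k)$ be a complete Noetherian local ring that is Cohen--Macaulay, and let $\omega_R$ be a canonical module of $R$, that is, a maximal Cohen--Macaulay $R$-module of type $1$ and of finite injective dimension. For a finitely generated $R$-module $M$ put $\beta_i(M)=\dim_k \operatorname{Tor}_i^R(k,M)$, and put \[ \lambda_{i,j}(R)=\dim_k \operatorname{Ext}^i_R\bigl(k,H^j_{\mathfrak m}(R)\bigr), \] where $H^j_{\mathfrak m}(R)=\varinjlim_n \operatorname{Ext}^j_R(R/\mathfrak m^n,R)$ is the local cohomology of $R$ with support in $\mathfrak m$. Then for every integer $i\ge 0$ \[ \beta_i(\omega_R)=\sum_{j=0}^{\dim R}\lambda_{i,j}(R). \] -/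

import Mathlib

open CategoryTheory IsLocalRing

universe u

noncomputable section

variable (R : Type u) [CommRing R] [IsLocalRing R]

/-- The residue field `k = R/𝔪`, as an object of the category of `R`-modules. -/
abbrev residueFieldObj : ModuleCat.{u} R := ModuleCat.of R (ResidueField R)

theorem smul_residueField_eq_zero {r : R} (hr : r ∈ maximalIdeal R) (x : ResidueField R) :
    r • x = 0 := by
  rw [Algebra.smul_def, ResidueField.algebraMap_eq, (residue_eq_zero_iff r).mpr hr, zero_mul]

theorem smul_id_residueFieldObj_eq_zero {r : R} (hr : r ∈ maximalIdeal R) :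
    r • 𝟙 (residueFieldObj R) = 0 := by
  ext x
  exact smul_residueField_eq_zero R hr x

/-- `Tor_i^R(k, M)`, as an `R`-module. -/
abbrev torResidueField (M : Type u) [AddCommGroup M] [Module R M] (i : ℕ) : ModuleCat.{u} R :=
  ((Tor (ModuleCat.{u} R) i).obj (residueFieldObj R)).obj (ModuleCat.of R M)

/-- `Tor_i^R(k, M)` is killed by the maximal ideal. -/
theorem torResidueField_isTorsionBySet (M : Type u) [AddCommGroup M] [Module R M] (i : ℕ) :
    Module.IsTorsionBySet R (torResidueField R M i) (maximalIdeal R : Set R) := by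
  rintro x ⟨r, hr⟩
  let P := projectiveResolution (ModuleCat.of R M)
  let F := (MonoidalCategory.tensoringLeft (ModuleCat.{u} R)).obj (residueFieldObj R)
  let K := (F.mapHomologicalComplex (ComplexShape.down ℕ)).obj P.complex
  let e : torResidueField R M i ≅ K.homology i := P.isoLeftDerivedObj F i
  have hK : r • 𝟙 K = 0 := by
    ext n : 1
    refine ModuleCat.hom_ext (TensorProduct.ext' fun a b => ?_)
    change r • (a ⊗ₜ[R] b : TensorProduct R (ResidueField R) (P.complex.X n)) = 0
    rw [TensorProduct.smul_tmul', smul_residueField_eq_zero R hr, TensorProduct.zero_tmul]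
  have hH : r • 𝟙 (K.homology i) = 0 := by
    have h1 : HomologicalComplex.homologyMap (r • 𝟙 K) i = r • 𝟙 (K.homology i) := by
      rw [← HomologicalComplex.homologyMap_id K i]
      exact ShortComplex.homologyMap_smul
        ((HomologicalComplex.shortComplexFunctor _ _ i).map (𝟙 K)) r
    rw [← h1, hK, HomologicalComplex.homologyMap_zero]
  have hx : r • e.hom x = 0 := congrArg (fun f : K.homology i ⟶ K.homology i => f (e.hom x)) hH
  have hx' : e.hom (r • x) = e.hom 0 := by rw [map_smul, hx, map_zero]
  exact e.toLinearEquiv.injective hx'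

/-- `Ext^i_R(k, N)` is killed by the maximal ideal. -/
theorem extResidueField_isTorsionBySet (N : ModuleCat.{u} R) (i : ℕ) :
    Module.IsTorsionBySet R (Abelian.Ext.{u} (residueFieldObj R) N i)
      (maximalIdeal R : Set R) := by
  rintro x ⟨r, hr⟩
  change r • x = 0
  rw [← Abelian.Ext.mk₀_id_comp x, ← Abelian.Ext.smul_comp, ← Abelian.Ext.mk₀_smul,
    smul_id_residueFieldObj_eq_zero R hr, Abelian.Ext.mk₀_zero, Abelian.Ext.zero_comp]

/-- `Tor_i^R(k, M)` as a vector space over `k = R/𝔪`, with the action induced from `R`. -/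
@[reducible]
def torResidueFieldModule (M : Type u) [AddCommGroup M] [Module R M] (i : ℕ) :
    Module (ResidueField R) (torResidueField R M i) :=
  (torResidueField_isTorsionBySet R M i).module

/-- `Ext^i_R(k, N)` as a vector space over `k = R/𝔪`, with the action induced from `R`. -/
@[reducible]
def extResidueFieldModule (N : ModuleCat.{u} R) (i : ℕ) :
    Module (ResidueField R) (Abelian.Ext.{u} (residueFieldObj R) N i) :=
  (extResidueField_isTorsionBySet R N i).module

/-- The `i`-th Betti number `β_i(M) = dim_k Tor_i^R(k, M)`. -/
def bettiNumber (M : Type u) [AddCommGroup M] [Module R M] (i : ℕ) : Cardinal.{u} :=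
  letI := torResidueFieldModule R M i
  Module.rank (ResidueField R) (torResidueField R M i)

/-- The `i`-th Bass number `dim_k Ext^i_R(k, N)` at the maximal ideal. -/
def bassNumber (N : ModuleCat.{u} R) (i : ℕ) : Cardinal.{u} :=
  letI := extResidueFieldModule R N i
  Module.rank (ResidueField R) (Abelian.Ext.{u} (residueFieldObj R) N i)

/-- The number `λ_{i,j}(R) = dim_k Ext^i_R(k, H^j_𝔪(R))`, where `H^j_𝔪` is local cohomology
with support in the maximal ideal. -/
def lyubeznikNumber (i j : ℕ) : Cardinal.{u} :=
  bassNumber R ((localCohomology (maximalIdeal R) j).obj (ModuleCat.of R R)) i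

/-- The depth of a module over a local ring: the supremum of the lengths of the `M`-regular
sequences in the maximal ideal. -/
def moduleDepth (M : Type u) [AddCommGroup M] [Module R M] : ℕ∞ :=
  ⨆ (rs : List R) (_ : RingTheory.Sequence.IsRegular M rs ∧ ∀ r ∈ rs, r ∈ maximalIdeal R),
    (rs.length : ℕ∞)

/-- A Noetherian local ring is Cohen-Macaulay if its depth equals its Krull dimension. -/
def IsCohenMacaulayLocal : Prop :=
  (moduleDepth R R : WithBot ℕ∞) = ringKrullDim R

/-- The type `dim_k Ext^t_R(k, M)`, `t = depth M`, of a (nonzero finitely generated) module. -/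
def moduleType (M : Type u) [AddCommGroup M] [Module R M] : Cardinal.{u} :=
  bassNumber R (ModuleCat.of R M) (moduleDepth R M).toNat

/-- A canonical module of a Cohen-Macaulay local ring: a maximal Cohen-Macaulay module of type `1`
and of finite injective dimension. -/
structure IsCanonicalModule (ω : Type u) [AddCommGroup ω] [Module R ω] : Prop where
  finite : Module.Finite R ω
  depth_eq : (moduleDepth R ω : WithBot ℕ∞) = ringKrullDim R
  type_eq_one : moduleType R ω = 1
  finite_injectiveDimension : ∃ n : ℕ, HasInjectiveDimensionLE (ModuleCat.of R ω) n

end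

/-! Let d = dim R. Since depth R = d, `Ext^j(k, R)` vanishes for j < d, hence so does `Ext^j(R/𝔪^n,
R)` by dévissage; therefore `H^j_𝔪(R) = 0` for j < d and only the summand j = d survives. The rest
is the chain dim Ext^i(k, H^d_𝔪(R)) = dim Ext^{d+i}(k, R) = dim Ext^i(ω, k) = dim Tor_i(k, ω).

First equality (`length_ext_eq_of_extColimit`). If M has positive depth, its injective hull E has no
socle, so E has neither Bass numbers at 𝔪 nor local cohomology, and replacing M by E/M lowers all
degrees by one. After d steps the local cohomology is the 𝔪-power torsion Γ of a module M. Since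
local cohomology vanishes in higher degrees (`ExtEventuallyZero.of_supportDim_le`), M/Γ has none at
all, hence no Bass numbers, and Γ and M have the same Ext(k, -).

Second equality (`length_ext_add_eq`). Divide R and ω by a common regular element x. As x kills k,
the long exact sequences break into short ones, and both sides obey the same recursion; equality for
the quotients then gives equality for R and ω by cancellation, one i at a time. At depth zero R has
become an Artinian ring R/J and ω a module N for which Hom(-, N) preserves lengths of finite length
modules killed by J. Then N embeds into W = E(k), a length count gives R/J ≅ Hom(N, W), and Matlis
duality (`length_ext_linearMap_eq`) converts Ext^i(k, Hom(N, W)) into Ext^i(N, k). The length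
property starts as a property of Ext^d(-, ω) (`length_ext_of_isFiniteLength`): it follows from type
one, depth d, and the vanishing of Ext^{d+1}(k, ω), which comes from finite injective dimension.

Third equality (`extResidueFieldEquiv`). For a projective resolution P of ω, Hom(P, k) is the k-dual
of k ⊗ P, and duality over a field is exact.

Lengths are counted over R in `ℕ∞`, where only finite terms cancel; they become dimensions over k at
the end. -/

open scoped Pointwise

noncomputable section

namespace CategoryTheory.Abelian.Ext

/-! ### Long exact sequences of Ext -/

section LES

variable {R : Type u} [CommRing R] {S : ShortComplex (ModuleCat.{u} R)} (hS : S.ShortExact)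

include hS in
theorem exact_postcomp_f_g (X : ModuleCat.{u} R) (n : ℕ) :
    Function.Exact ((mk₀ S.f).postcompOfLinear R X (add_zero n))
      ((mk₀ S.g).postcompOfLinear R X (add_zero n)) := by
  intro x
  refine ⟨fun h => covariant_sequence_exact₂ X hS x h, ?_⟩
  rintro ⟨y, rfl⟩
  change (y.comp (mk₀ S.f) (add_zero n)).comp (mk₀ S.g) (add_zero n) = 0
  simp only [comp_assoc_of_third_deg_zero, mk₀_comp_mk₀, ShortComplex.zero, mk₀_zero, comp_zero]

theorem exact_postcomp_g_δ (X : ModuleCat.{u} R) (n : ℕ) :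
    Function.Exact ((mk₀ S.g).postcompOfLinear R X (add_zero n))
      (hS.extClass.postcompOfLinear R X (rfl : n + 1 = n + 1)) := by
  intro x
  refine ⟨fun h => covariant_sequence_exact₃ X hS x rfl h, ?_⟩
  rintro ⟨y, rfl⟩
  change (y.comp (mk₀ S.g) (add_zero n)).comp hS.extClass rfl = 0
  simp only [comp_assoc_of_second_deg_zero, ShortComplex.ShortExact.comp_extClass, comp_zero]

theorem exact_postcomp_δ_f (X : ModuleCat.{u} R) (n : ℕ) :
    Function.Exact (hS.extClass.postcompOfLinear R X (rfl : n + 1 = n + 1))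
      ((mk₀ S.f).postcompOfLinear R X (add_zero (n + 1))) := by
  intro x
  refine ⟨fun h => covariant_sequence_exact₁ X hS x h rfl, ?_⟩
  rintro ⟨y, rfl⟩
  change (y.comp hS.extClass rfl).comp (mk₀ S.f) (add_zero (n + 1)) = 0
  simp only [comp_assoc_of_third_deg_zero, ShortComplex.ShortExact.extClass_comp, comp_zero]

include hS in
theorem exact_precomp_g_f (Y : ModuleCat.{u} R) (n : ℕ) :
    Function.Exact ((mk₀ S.g).precompOfLinear R Y (zero_add n))
      ((mk₀ S.f).precompOfLinear R Y (zero_add n)) := by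
  intro x
  refine ⟨fun h => contravariant_sequence_exact₂ hS Y x h, ?_⟩
  rintro ⟨y, rfl⟩
  change (mk₀ S.f).comp ((mk₀ S.g).comp y (zero_add n)) (zero_add n) = 0
  simp only [mk₀_comp_mk₀_assoc, ShortComplex.zero, mk₀_zero, zero_comp]

theorem exact_precomp_f_δ (Y : ModuleCat.{u} R) (n : ℕ) :
    Function.Exact ((mk₀ S.f).precompOfLinear R Y (zero_add n))
      (hS.extClass.precompOfLinear R Y (add_comm 1 n)) := by
  intro x
  refine ⟨fun h => contravariant_sequence_exact₁ hS Y x (add_comm 1 n) h, ?_⟩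
  rintro ⟨y, rfl⟩
  change hS.extClass.comp ((mk₀ S.f).comp y (zero_add n)) (add_comm 1 n) = 0
  simp only [ShortComplex.ShortExact.extClass_comp_assoc]

theorem exact_precomp_δ_g (Y : ModuleCat.{u} R) (n : ℕ) :
    Function.Exact (hS.extClass.precompOfLinear R Y (add_comm 1 n))
      ((mk₀ S.g).precompOfLinear R Y (zero_add (n + 1))) := by
  intro x
  refine ⟨fun h => contravariant_sequence_exact₃ hS Y x h (add_comm 1 n), ?_⟩
  rintro ⟨y, rfl⟩
  change (mk₀ S.g).comp (hS.extClass.comp y (add_comm 1 n)) (zero_add (n + 1)) = 0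
  simp only [ShortComplex.ShortExact.comp_extClass_assoc]

include hS in
theorem injective_postcomp_f (X : ModuleCat.{u} R) :
    Function.Injective ((mk₀ S.f).postcompOfLinear R X (add_zero 0)) :=
  have := hS.mono_f
  postcomp_mk₀_injective_of_mono X S.f

include hS in
theorem injective_precomp_g (Y : ModuleCat.{u} R) :
    Function.Injective ((mk₀ S.g).precompOfLinear R Y (zero_add 0)) :=
  have := hS.epi_g
  precomp_mk₀_injective_of_epi Y S.g

include hS in
theorem subsingleton_trd {X : ModuleCat.{u} R} {n : ℕ} (h₂ : Subsingleton (Ext.{u} X S.X₂ n))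
    (h₁ : Subsingleton (Ext.{u} X S.X₁ (n + 1))) : Subsingleton (Ext.{u} X S.X₃ n) := by
  refine subsingleton_of_forall_eq 0 fun x => ?_
  obtain ⟨y, rfl⟩ := (exact_postcomp_g_δ hS X n x).1 (Subsingleton.elim _ _)
  rw [Subsingleton.elim y 0, map_zero]

include hS in
theorem subsingleton_fst {X : ModuleCat.{u} R} {n : ℕ} (h₃ : Subsingleton (Ext.{u} X S.X₃ n))
    (h₂ : Subsingleton (Ext.{u} X S.X₂ (n + 1))) : Subsingleton (Ext.{u} X S.X₁ (n + 1)) := by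
  refine subsingleton_of_forall_eq 0 fun x => ?_
  obtain ⟨y, rfl⟩ := (exact_postcomp_δ_f hS X n x).1 (Subsingleton.elim _ _)
  rw [Subsingleton.elim y 0, map_zero]

include hS in
theorem subsingleton_snd_left {Y : ModuleCat.{u} R} {n : ℕ}
    (h₁ : Subsingleton (Ext.{u} S.X₁ Y n)) (h₃ : Subsingleton (Ext.{u} S.X₃ Y n)) :
    Subsingleton (Ext.{u} S.X₂ Y n) := by
  refine subsingleton_of_forall_eq 0 fun x => ?_
  obtain ⟨y, rfl⟩ := (exact_precomp_g_f hS Y n x).1 (Subsingleton.elim _ _)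
  rw [Subsingleton.elim y 0, map_zero]

include hS in
theorem subsingleton_fst_left {Y : ModuleCat.{u} R} {n : ℕ}
    (h₂ : Subsingleton (Ext.{u} S.X₂ Y n)) (h₃ : Subsingleton (Ext.{u} S.X₃ Y (n + 1))) :
    Subsingleton (Ext.{u} S.X₁ Y n) := by
  refine subsingleton_of_forall_eq 0 fun x => ?_
  obtain ⟨y, rfl⟩ := (exact_precomp_f_δ hS Y n x).1 (Subsingleton.elim _ _)
  rw [Subsingleton.elim y 0, map_zero]

/-- The connecting map is bijective when the middle term has no cohomology. -/
def shiftEquiv (X : ModuleCat.{u} R) (n : ℕ) (h₀ : Subsingleton (Ext.{u} X S.X₂ n))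
    (h₁ : Subsingleton (Ext.{u} X S.X₂ (n + 1))) :
    Ext.{u} X S.X₃ n ≃ₗ[R] Ext.{u} X S.X₁ (n + 1) :=
  LinearEquiv.ofBijective (hS.extClass.postcompOfLinear R X (rfl : n + 1 = n + 1)) <| by
    refine ⟨(injective_iff_map_eq_zero _).2 fun x hx => ?_, fun x => ?_⟩
    · obtain ⟨y, rfl⟩ := (exact_postcomp_g_δ hS X n x).1 hx
      rw [Subsingleton.elim y 0, map_zero]
    · exact (exact_postcomp_δ_f hS X n x).1 (Subsingleton.elim _ _)

/-- The connecting map is bijective when the middle term has no cohomology. -/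
def shiftEquivLeft (Y : ModuleCat.{u} R) (n : ℕ) (h₀ : Subsingleton (Ext.{u} S.X₂ Y n))
    (h₁ : Subsingleton (Ext.{u} S.X₂ Y (n + 1))) :
    Ext.{u} S.X₁ Y n ≃ₗ[R] Ext.{u} S.X₃ Y (n + 1) :=
  LinearEquiv.ofBijective (hS.extClass.precompOfLinear R Y (add_comm 1 n)) <| by
    refine ⟨(injective_iff_map_eq_zero _).2 fun x hx => ?_, fun x => ?_⟩
    · obtain ⟨y, rfl⟩ := (exact_precomp_f_δ hS Y n x).1 hx
      rw [Subsingleton.elim y 0, map_zero]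
    · exact (exact_precomp_δ_g hS Y n x).1 (Subsingleton.elim _ _)

/-- `Ext` is linear-isomorphic in the second variable. -/
def congrRight (X : ModuleCat.{u} R) {Y Y' : ModuleCat.{u} R} (e : Y ≅ Y') (n : ℕ) :
    Ext.{u} X Y n ≃ₗ[R] Ext.{u} X Y' n :=
  LinearEquiv.ofLinearMap ((mk₀ e.hom).postcompOfLinear R X (add_zero n))
    ((mk₀ e.inv).postcompOfLinear R X (add_zero n))
    (by ext x
        change (x.comp (mk₀ e.inv) (add_zero n)).comp (mk₀ e.hom) (add_zero n) = x
        simp)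
    (by ext x
        change (x.comp (mk₀ e.hom) (add_zero n)).comp (mk₀ e.inv) (add_zero n) = x
        simp)

/-- `Ext` is linear-isomorphic in the first variable. -/
def congrLeft {X X' : ModuleCat.{u} R} (e : X ≅ X') (Y : ModuleCat.{u} R) (n : ℕ) :
    Ext.{u} X' Y n ≃ₗ[R] Ext.{u} X Y n :=
  LinearEquiv.ofLinearMap ((mk₀ e.hom).precompOfLinear R Y (zero_add n))
    ((mk₀ e.inv).precompOfLinear R Y (zero_add n))
    (by ext x
        change (mk₀ e.hom).comp ((mk₀ e.inv).comp x (zero_add n)) (zero_add n) = x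
        simp)
    (by ext x
        change (mk₀ e.inv).comp ((mk₀ e.hom).comp x (zero_add n)) (zero_add n) = x
        simp)

/-- `Ext` in degree zero between bundled modules. -/
def linearMapEquiv (M N : Type u) [AddCommGroup M] [Module R M] [AddCommGroup N] [Module R N] :
    Ext.{u} (ModuleCat.of R M) (ModuleCat.of R N) 0 ≃ₗ[R] (M →ₗ[R] N) :=
  Ext.linearEquiv₀.trans ModuleCat.homLinearEquiv

theorem linearMapEquiv_mk₀ {M N : Type u} [AddCommGroup M] [Module R M] [AddCommGroup N]
    [Module R N] (f : M →ₗ[R] N) : linearMapEquiv M N (mk₀ (ModuleCat.ofHom f)) = f := by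
  rw [← LinearEquiv.eq_symm_apply]
  rfl

/-- The action of `r` on Ext can be computed by composing with `r • 𝟙 X`. -/
theorem smul_eq_zero_of_left {X Y : ModuleCat.{u} R} {n : ℕ} {r : R} (h : ∀ x : X, r • x = 0)
    (e : Ext.{u} X Y n) : r • e = 0 := by
  have : r • 𝟙 X = 0 := by ext x; exact h x
  rw [← mk₀_id_comp e, ← smul_comp, ← mk₀_smul, this, mk₀_zero, zero_comp]

theorem smul_eq_zero_of_right {X Y : ModuleCat.{u} R} {n : ℕ} {r : R} (h : ∀ x : Y, r • x = 0)
    (e : Ext.{u} X Y n) : r • e = 0 := by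
  have : r • 𝟙 Y = 0 := by ext x; exact h x
  rw [← comp_mk₀_id e, ← comp_smul, ← mk₀_smul, this, mk₀_zero, comp_zero]

theorem subsingleton_of_isZero_right {X Y : ModuleCat.{u} R} [Subsingleton Y] (n : ℕ) :
    Subsingleton (Ext.{u} X Y n) := by
  refine subsingleton_of_forall_eq 0 fun x => ?_
  rw [← one_smul R x]
  exact smul_eq_zero_of_right (fun _ => Subsingleton.elim _ _) x

theorem subsingleton_of_isZero_left {X Y : ModuleCat.{u} R} [Subsingleton X] (n : ℕ) :
    Subsingleton (Ext.{u} X Y n) := by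
  refine subsingleton_of_forall_eq 0 fun x => ?_
  rw [← one_smul R x]
  exact smul_eq_zero_of_left (fun _ => Subsingleton.elim _ _) x

end LES

end CategoryTheory.Abelian.Ext

/-- The short exact sequence of a submodule and its quotient. -/
abbrev Submodule.shortComplexMkQ {R : Type u} [CommRing R] {M : Type u} [AddCommGroup M]
    [Module R M] (N : Submodule R M) : ShortComplex (ModuleCat.{u} R) :=
  ModuleCat.shortComplexOfCompEqZero N.subtype N.mkQ (by ext; simp)

theorem Submodule.shortExact_mkQ {R : Type u} [CommRing R] {M : Type u} [AddCommGroup M]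
    [Module R M] (N : Submodule R M) : N.shortComplexMkQ.ShortExact where
  exact := ModuleCat.shortComplex_exact _ (LinearMap.exact_subtype_mkQ N)
  mono_f := by
    rw [ModuleCat.mono_iff_injective]; exact N.injective_subtype
  epi_g := by
    rw [ModuleCat.epi_iff_surjective]; exact N.mkQ_surjective

/-! ### Length and dévissage over a local ring -/

section Length

variable {R : Type u} [CommRing R]

/-- Euler characteristic of `0 → A → B → C → D → 0`. -/
theorem Module.length_add_eq_of_exact {A B C D : Type*} [AddCommGroup A] [AddCommGroup B]
    [AddCommGroup C] [AddCommGroup D] [Module R A] [Module R B] [Module R C] [Module R D]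
    (f : A →ₗ[R] B) (g : B →ₗ[R] C) (h : C →ₗ[R] D) (hf : Function.Injective f)
    (hfg : Function.Exact f g) (hgh : Function.Exact g h) (hh : Function.Surjective h) :
    Module.length R B + Module.length R D = Module.length R A + Module.length R C := by
  have h1 := Module.length_eq_add_of_exact f g.rangeRestrict hf g.surjective_rangeRestrict
    (by
      intro x
      rw [← hfg x, Subtype.ext_iff]
      rfl)
  have h2 := Module.length_eq_add_of_exact (LinearMap.range g).subtype h
    (Submodule.injective_subtype _) hh (by
      intro x
      rw [hgh x]
      simp)
  rw [h1, h2, add_assoc]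

theorem LinearMap.bijective_of_injective_of_length_eq {A B : Type*} [AddCommGroup A]
    [AddCommGroup B] [Module R A] [Module R B] (f : A →ₗ[R] B) (hf : Function.Injective f)
    (h : Module.length R A = Module.length R B) (hB : Module.length R A ≠ ⊤) :
    Function.Bijective f := by
  refine ⟨hf, ?_⟩
  have h1 := Module.length_eq_add_of_exact f (LinearMap.range f).mkQ hf
    (Submodule.mkQ_surjective _) (LinearMap.exact_map_mkQ_range f)
  rw [← h] at h1
  have h2 : Module.length R (B ⧸ LinearMap.range f) = 0 := by
    obtain ⟨a, ha⟩ := ENat.ne_top_iff_exists.1 hB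
    rw [← ha] at h1
    exact ENat.add_right_injective_of_ne_top (ENat.natCast_ne_top a) (by
      change (a : ℕ∞) + _ = a + 0
      rw [← h1, add_zero])
  rw [Module.length_eq_zero_iff, Submodule.Quotient.subsingleton_iff] at h2
  exact LinearMap.range_eq_top.1 h2

variable [IsLocalRing R]

theorem IsLocalRing.nonempty_linearEquiv_of_isSimpleModule (M : Type*) [AddCommGroup M]
    [Module R M] [IsSimpleModule R M] : Nonempty (M ≃ₗ[R] ResidueField R) := by
  obtain ⟨I, hI, ⟨e⟩⟩ := isSimpleModule_iff_quot_maximal.1 ‹IsSimpleModule R M›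
  obtain rfl := IsLocalRing.eq_maximalIdeal hI
  exact ⟨e⟩

instance : IsSimpleModule R (ResidueField R) :=
  isSimpleModule_iff_quot_maximal.2 ⟨maximalIdeal R, inferInstance, ⟨LinearEquiv.refl R _⟩⟩

/-- Dévissage of modules of finite length over a local ring. -/
theorem IsFiniteLength.devissage {P : ∀ (M : Type u) [AddCommGroup M] [Module R M], Prop}
    (zero : ∀ (M : Type u) [AddCommGroup M] [Module R M] [Subsingleton M], P M)
    (ext : ∀ (M : Type u) [AddCommGroup M] [Module R M] (N : Submodule R M),
      Nonempty ((M ⧸ N) ≃ₗ[R] ResidueField R) → IsFiniteLength R N → P N → P M)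
    {M : Type u} [AddCommGroup M] [Module R M] (h : IsFiniteLength R M) : P M := by
  induction h with
  | of_subsingleton => exact zero _
  | @of_simple_quotient M _ _ N _ hN ih =>
    exact ext M N (IsLocalRing.nonempty_linearEquiv_of_isSimpleModule _) hN ih

/-- Ext is half exact, so vanishing on k spreads along a composition series, all of whose factors
are k. -/
theorem subsingleton_ext_of_isFiniteLength {V : ModuleCat.{u} R} {i : ℕ}
    (hV : Subsingleton (Abelian.Ext.{u} (residueFieldObj R) V i))
    {X : Type u} [AddCommGroup X] [Module R X] (hX : IsFiniteLength R X) :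
    Subsingleton (Abelian.Ext.{u} (ModuleCat.of R X) V i) := by
  refine hX.devissage (P := fun X _ _ => Subsingleton (Abelian.Ext.{u} (ModuleCat.of R X) V i)) ?_ ?_
  · intro M _ _ _
    exact Abelian.Ext.subsingleton_of_isZero_left (X := ModuleCat.of R M) i
  · rintro M _ _ N ⟨e⟩ - hN
    refine Abelian.Ext.subsingleton_snd_left N.shortExact_mkQ hN ?_
    exact (Abelian.Ext.congrLeft e.toModuleIso V i).symm.subsingleton

/-- If `Ext(k, V)` is concentrated near degree `s` and one-dimensional there, then `Ext^s(-, V)`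
preserves the length. -/
theorem length_ext_of_isFiniteLength {V : ModuleCat.{u} R} {s : ℕ}
    (h₀ : ∀ j, j + 1 = s → Subsingleton (Abelian.Ext.{u} (residueFieldObj R) V j))
    (h₁ : Subsingleton (Abelian.Ext.{u} (residueFieldObj R) V (s + 1)))
    (hs : Module.length R (Abelian.Ext.{u} (residueFieldObj R) V s) = 1)
    {X : Type u} [AddCommGroup X] [Module R X] (hX : IsFiniteLength R X) :
    Module.length R (Abelian.Ext.{u} (ModuleCat.of R X) V s) = Module.length R X := by
  induction hX with
  | @of_subsingleton M _ _ _ =>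
    exact (Module.length_eq_zero_iff.2
      (Abelian.Ext.subsingleton_of_isZero_left (X := ModuleCat.of R M) (Y := V) s)).trans
      (Module.length_eq_zero_iff.2 ‹_›).symm
  | @of_simple_quotient M _ _ N _ hNf hN =>
    obtain ⟨e⟩ := IsLocalRing.nonempty_linearEquiv_of_isSimpleModule (R := R) (M ⧸ N)
    have hS := N.shortExact_mkQ
    have key := Module.length_eq_add_of_exact
      ((Abelian.Ext.mk₀ N.shortComplexMkQ.g).precompOfLinear R V (zero_add s))
      ((Abelian.Ext.mk₀ N.shortComplexMkQ.f).precompOfLinear R V (zero_add s)) ?_ ?_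
      (Abelian.Ext.exact_precomp_g_f hS V s)
    · refine key.trans ?_
      rw [Module.length_eq_add_of_exact N.subtype N.mkQ N.injective_subtype N.mkQ_surjective
        (LinearMap.exact_subtype_mkQ N), add_comm]
      exact congrArg₂ (· + ·) hN (((Abelian.Ext.congrLeft e.toModuleIso V s).symm.length_eq.trans
        hs).trans ((Module.length_eq_one R (ResidueField R)).symm.trans e.length_eq.symm))
    -- Injectivity is left exactness when s = 0. Otherwise the obstruction comes from Ext of `N` one
    -- degree lower, which `h₀` kills by dévissage.
    · obtain _ | s := s
      · exact Abelian.Ext.injective_precomp_g hS V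
      · refine (injective_iff_map_eq_zero _).2 fun x hx => ?_
        obtain ⟨y, rfl⟩ := (Abelian.Ext.exact_precomp_δ_g hS V s x).1 hx
        have := subsingleton_ext_of_isFiniteLength (h₀ s rfl) hNf
        rw [Subsingleton.elim y 0, map_zero]
    · intro x
      have : Subsingleton (Abelian.Ext.{u} N.shortComplexMkQ.X₃ V (s + 1)) :=
        (Abelian.Ext.congrLeft e.toModuleIso V (s + 1)).symm.subsingleton
      exact (Abelian.Ext.exact_precomp_f_δ hS V s x).1 (Subsingleton.elim _ _)

end Length

/-! ### Injective hulls -/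

section EssentialHull

variable {R : Type u} [CommRing R]

/-- A linear map is essential if every nonzero element of the target has a nonzero multiple in
the range. -/
def LinearMap.IsEssential {M E : Type*} [AddCommGroup M] [Module R M] [AddCommGroup E] [Module R E]
    (f : M →ₗ[R] E) : Prop :=
  ∀ x : E, x ≠ 0 → ∃ r : R, r • x ≠ 0 ∧ r • x ∈ LinearMap.range f

theorem Submodule.exists_maximal_essential {I : Type u} [AddCommGroup I] [Module R I]
    (N : Submodule R I) :
    ∃ W, Maximal (fun W : Submodule R I =>
      N ≤ W ∧ ∀ x ∈ W, x ≠ 0 → ∃ r : R, r • x ≠ 0 ∧ r • x ∈ N) W := by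
  refine (zorn_le_nonempty₀
    {W : Submodule R I | N ≤ W ∧ ∀ x ∈ W, x ≠ 0 → ∃ r : R, r • x ≠ 0 ∧ r • x ∈ N} ?_ N
    ⟨le_rfl, fun x hx hx0 => ⟨1, by rwa [one_smul], by rwa [one_smul]⟩⟩).imp fun _ h => h.2
  intro c hc hchain y hy
  refine ⟨sSup c, ⟨(hc hy).1.trans (le_sSup hy), fun x hx hx0 => ?_⟩, fun z => le_sSup⟩
  obtain ⟨V, hV, hxV⟩ := (Submodule.mem_sSup_of_directed ⟨y, hy⟩ hchain.directedOn).1 hx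
  exact (hc hV).2 x hxV hx0

theorem Submodule.exists_maximal_disjoint {I : Type u} [AddCommGroup I] [Module R I]
    (W : Submodule R I) :
    ∃ K, Maximal (fun K : Submodule R I => ∀ x ∈ K, x ∈ W → x = 0) K := by
  refine (zorn_le_nonempty₀ {K : Submodule R I | ∀ x ∈ K, x ∈ W → x = 0} ?_ ⊥
    (fun x hx _ => (Submodule.mem_bot R).1 hx)).imp fun _ h => h.2
  intro c hc hchain y hy
  refine ⟨sSup c, fun x hx hxW => ?_, fun z => le_sSup⟩
  obtain ⟨V, hV, hxV⟩ := (Submodule.mem_sSup_of_directed ⟨y, hy⟩ hchain.directedOn).1 hx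
  exact hc hV x hxV hxW

/-- A maximal essential extension inside an injective module is a retract. -/
theorem Module.Injective.exists_retraction {I : Type u} [AddCommGroup I] [Module R I]
    [Module.Injective R I] {N W : Submodule R I}
    (hW : Maximal (fun W : Submodule R I =>
      N ≤ W ∧ ∀ x ∈ W, x ≠ 0 → ∃ r : R, r • x ≠ 0 ∧ r • x ∈ N) W) :
    ∃ h : I →ₗ[R] W, ∀ w : W, h w = w := by
  -- With `K` maximal subject to K ∩ W = 0, the map W → I/K is injective, and injectivity of `I`
  -- extends the inclusion of `W` to `g` on I/K.
  obtain ⟨K, hK⟩ := W.exists_maximal_disjoint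
  have hinj : Function.Injective (K.mkQ ∘ₗ W.subtype) := by
    refine (injective_iff_map_eq_zero _).2 fun w hw => Subtype.ext ?_
    exact hK.prop w ((Submodule.Quotient.mk_eq_zero K).1 hw) w.2
  obtain ⟨g, hg⟩ := Module.Injective.out (K.mkQ ∘ₗ W.subtype) hinj W.subtype
  let h : I →ₗ[R] I := g ∘ₗ K.mkQ
  have hhW : ∀ w ∈ W, h w = w := fun w hw => hg ⟨w, hw⟩
  -- Maximality of `K`: adjoining y ∉ K forces a nonzero element k + r y of W, and `h` fixes it
  -- while killing k.
  have hker : ∀ y, y ∉ K → ∃ r : R, ∃ w ∈ W, w ≠ 0 ∧ h (r • y) = w := by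
    intro y hy
    by_contra! hcon
    refine hy (hK.le_of_ge (y := K ⊔ Submodule.span R {y}) ?_ le_sup_left
      (Submodule.mem_sup_right (Submodule.mem_span_singleton_self y)))
    intro x hx hxW
    obtain ⟨k, hk, z, hz, rfl⟩ := Submodule.mem_sup.1 hx
    obtain ⟨r, rfl⟩ := Submodule.mem_span_singleton.1 hz
    by_contra hne
    refine hcon r _ hxW hne ?_
    rw [← hhW _ hxW, map_add]
    have : h k = 0 := by
      change g (K.mkQ k) = 0
      rw [Submodule.mkQ_apply, (Submodule.Quotient.mk_eq_zero K).2 hk, map_zero]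
    rw [this, zero_add]
  -- The image of `h` contains `W` and is still essential over `N`, so maximality of `W` forces it
  -- to be `W`.
  have hle : LinearMap.range h ≤ W := by
    refine hW.le_of_ge ⟨?_, ?_⟩ ?_
    · exact fun x hx => ⟨x, hhW x (hW.prop.1 hx)⟩
    · rintro _ ⟨y, rfl⟩ hy0
      have hy : y ∉ K := fun hyK => hy0 (by
        change g (K.mkQ y) = 0
        rw [Submodule.mkQ_apply, (Submodule.Quotient.mk_eq_zero K).2 hyK, map_zero])
      obtain ⟨r, w, hw, hw0, hrw⟩ := hker y hy
      obtain ⟨s, hs0, hsN⟩ := hW.prop.2 w hw hw0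
      refine ⟨s * r, ?_⟩
      rw [mul_smul, ← map_smul, hrw]
      exact ⟨hs0, hsN⟩
    · exact fun x hx => ⟨x, hhW x hx⟩
  exact ⟨h.codRestrict W fun y => hle ⟨y, rfl⟩, fun w => Subtype.ext (hhW w w.2)⟩

/-- Every module has an essential embedding into an injective module. -/
theorem Module.exists_essential_injective (M : Type u) [AddCommGroup M] [Module R M] :
    ∃ (E : Type u) (_ : AddCommGroup E) (_ : Module R E) (f : M →ₗ[R] E),
      Module.Injective R E ∧ Function.Injective f ∧ f.IsEssential := by
  let I := CategoryTheory.Injective.under (ModuleCat.of R M)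
  let ι : M →ₗ[R] I := (CategoryTheory.Injective.ι (ModuleCat.of R M)).hom
  have hι : Function.Injective ι := (ModuleCat.mono_iff_injective _).1 inferInstance
  have hI : Module.Injective R I := by
    have : CategoryTheory.Injective (ModuleCat.of R I) :=
      inferInstanceAs (CategoryTheory.Injective (CategoryTheory.Injective.under (ModuleCat.of R M)))
    exact Module.injective_module_of_injective_object R I
  obtain ⟨W, hW⟩ := (LinearMap.range ι).exists_maximal_essential
  obtain ⟨h, hh⟩ := Module.Injective.exists_retraction hW
  refine ⟨W, inferInstance, inferInstance, ι.codRestrict W fun x => hW.prop.1 ⟨x, rfl⟩, ⟨?_⟩,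
    fun x y hxy => hι (congrArg Subtype.val hxy), ?_⟩
  · intro X Y _ _ _ _ f hf g
    obtain ⟨k, hk⟩ := hI.out f hf (W.subtype ∘ₗ g)
    exact ⟨h ∘ₗ k, fun x => by
      rw [LinearMap.comp_apply, hk]
      exact hh (g x)⟩
  · intro x hx
    obtain ⟨r, hr0, y, hy⟩ := hW.prop.2 x x.2 (fun h0 => hx (Subtype.ext h0))
    exact ⟨r, fun h0 => hr0 (congrArg Subtype.val h0), y, Subtype.ext hy⟩

end EssentialHull

/-! ### The injective hull of k and Matlis duality -/

section MatlisDual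

variable {R : Type u} [CommRing R]

/-- Such a module is a quotient of a finite power of R/J. -/
theorem isFiniteLength_of_smul_eq_zero {J : Ideal R} (hJ : IsFiniteLength R (R ⧸ J)) (M : Type u)
    [AddCommGroup M] [Module R M] [Module.Finite R M] (h : ∀ r ∈ J, ∀ x : M, r • x = 0) :
    IsFiniteLength R M := by
  have hM : Module.IsTorsionBySet R M (J : Set R) := fun x r => h r r.2 x
  let := hM.module
  have : IsScalarTower R (R ⧸ J) M := hM.isScalarTower
  have : Module.Finite (R ⧸ J) M := Module.Finite.of_restrictScalars_finite R (R ⧸ J) M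
  obtain ⟨n, f, hf⟩ := Module.Finite.exists_fin' (R ⧸ J) M
  have h1 : IsFiniteLength R (Fin n → R ⧸ J) := by
    rw [← Module.length_ne_top_iff] at hJ ⊢
    rw [Module.length_pi]
    exact WithTop.mul_ne_top (by
      rw [ENat.card_eq_coe_fintype_card]
      exact ENat.natCast_ne_top _) hJ
  exact h1.of_surjective (f := f.restrictScalars R) hf

variable [IsLocalRing R]

theorem smul_ext_residueField_eq_zero {r : R} (hr : r ∈ maximalIdeal R) {V : ModuleCat.{u} R}
    {i : ℕ} (x : Abelian.Ext.{u} V (residueFieldObj R) i) : r • x = 0 :=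
  Abelian.Ext.smul_eq_zero_of_right (smul_residueField_eq_zero R hr) x

theorem isFiniteLength_residueField : IsFiniteLength R (ResidueField R) :=
  Module.length_ne_top_iff.1 (by rw [Module.length_eq_one]; exact ENat.one_ne_top)

/-- This finiteness is what permits cancelling such terms in `ℕ∞`. -/
theorem length_ext_residueField_ne_top [IsNoetherianRing R] (N : Type u) [AddCommGroup N]
    [Module R N] [Module.Finite R N] (i : ℕ) :
    Module.length R (Abelian.Ext.{u} (ModuleCat.of R N) (residueFieldObj R) i) ≠ ⊤ :=
  Module.length_ne_top_iff.2 <| isFiniteLength_of_smul_eq_zero (J := maximalIdeal R)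
    isFiniteLength_residueField _ fun _ hr x => smul_ext_residueField_eq_zero hr x

variable (R) in
/-- The injective hull of the residue field. -/
theorem exists_injective_hull_residueField :
    ∃ (W : Type u) (_ : AddCommGroup W) (_ : Module R W), Module.Injective R W ∧
      Module.length R (Abelian.Ext.{u} (residueFieldObj R) (ModuleCat.of R W) 0) = 1 := by
  obtain ⟨W, _, _, f, hW, hf, hess⟩ := Module.exists_essential_injective (R := R) (ResidueField R)
  refine ⟨W, _, _, hW, ?_⟩
  let φ : ResidueField R →ₗ[R] (ResidueField R →ₗ[R] W) :=
    (LinearMap.mul R (ResidueField R)).compr₂ f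
  have hφ : Function.Bijective φ := by
    refine ⟨(injective_iff_map_eq_zero _).2 fun a ha => ?_, fun g => ?_⟩
    · have : f (a * 1) = 0 := LinearMap.congr_fun ha 1
      rw [mul_one] at this
      exact (map_eq_zero_iff f hf).1 this
    -- The element `g 1` is killed by 𝔪. Essentiality moves it into the image of k by a scalar not
    -- killing it, which must therefore be a unit.
    · have key : ∃ a, f a = g 1 := by
        by_cases hg : g 1 = 0
        · exact ⟨0, by rw [map_zero, hg]⟩
        · obtain ⟨r, hr0, b, hb⟩ := hess _ hg
          have hr : IsUnit r := by
            by_contra hr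
            refine hr0 ?_
            rw [← map_smul, smul_residueField_eq_zero R ((mem_maximalIdeal r).2 hr), map_zero]
          obtain ⟨s, rfl⟩ := hr
          exact ⟨((s⁻¹ : Rˣ) : R) • b, by rw [map_smul, hb, smul_smul, Units.inv_mul, one_smul]⟩
      obtain ⟨a, ha⟩ := key
      refine ⟨a, LinearMap.ext fun x => ?_⟩
      obtain ⟨r, rfl⟩ := residue_surjective x
      change f (a * residue R r) = g (residue R r)
      rw [mul_comm, ← ResidueField.algebraMap_eq, ← Algebra.smul_def, map_smul, ha, ← map_smul,
        Algebra.smul_def, mul_one]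
  rw [(Abelian.Ext.linearMapEquiv (ResidueField R) W).length_eq,
    ← (LinearEquiv.ofBijective φ hφ).length_eq, Module.length_eq_one]

-- Maps X → Hom(P, W) are maps P → Hom(X, W), and projectivity of `P` lifts the latter along the
-- surjection Hom(Y, W) → Hom(X, W).
omit [IsLocalRing R] in
theorem Module.Injective.linearMap_of_projective (P W : Type u) [AddCommGroup P] [Module R P]
    [AddCommGroup W] [Module R W] [Module.Projective R P] [Module.Injective R W] :
    Module.Injective R (P →ₗ[R] W) where
  out X Y _ _ _ _ f hf g := by
    have hsurj : Function.Surjective (LinearMap.lcomp R W f) := fun a =>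
      Module.Injective.extension_property R W X Y f hf a
    obtain ⟨k, hk⟩ := Module.projective_lifting_property (LinearMap.lcomp R W f) g.flip hsurj
    refine ⟨k.flip, fun x => LinearMap.ext fun p => ?_⟩
    exact LinearMap.congr_fun (LinearMap.congr_fun hk p) x

/-- `Hom(-, W)` turns a short exact sequence into a short exact sequence. -/
abbrev LinearMap.shortComplexHom {P N : Type u} [AddCommGroup P] [Module R P]
    [AddCommGroup N] [Module R N] (f : P →ₗ[R] N) (W : Type u) [AddCommGroup W] [Module R W] :
    ShortComplex (ModuleCat.{u} R) :=
  ModuleCat.shortComplexOfCompEqZero (LinearMap.lcomp R W f)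
    (LinearMap.lcomp R W (LinearMap.ker f).subtype) (by
      ext g x
      change g (f x) = 0
      rw [x.2, map_zero])

omit [IsLocalRing R] in
theorem LinearMap.shortExact_shortComplexHom {P N : Type u} [AddCommGroup P] [Module R P]
    [AddCommGroup N] [Module R N] {f : P →ₗ[R] N} (hf : Function.Surjective f) (W : Type u)
    [AddCommGroup W] [Module R W] [Module.Injective R W] :
    (f.shortComplexHom W).ShortExact where
  exact := by
    refine ModuleCat.shortComplex_exact _ fun g => ⟨fun hg => ?_, ?_⟩
    · have hle : LinearMap.ker f ≤ LinearMap.ker g := fun x hx =>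
        LinearMap.congr_fun hg ⟨x, hx⟩
      refine ⟨(LinearMap.ker f).liftQ g hle ∘ₗ (f.quotKerEquivOfSurjective hf).symm.toLinearMap,
        LinearMap.ext fun x => ?_⟩
      change (LinearMap.ker f).liftQ g hle ((f.quotKerEquivOfSurjective hf).symm (f x)) = g x
      have : (f.quotKerEquivOfSurjective hf).symm (f x) = Submodule.Quotient.mk x :=
        (LinearEquiv.symm_apply_eq _).2 rfl
      rw [this, Submodule.liftQ_apply]
    · rintro ⟨h, rfl⟩
      ext x
      change h (f x) = 0
      rw [x.2, map_zero]
  mono_f := by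
    rw [ModuleCat.mono_iff_injective]
    intro a b hab
    refine LinearMap.ext fun x => ?_
    obtain ⟨y, rfl⟩ := hf x
    exact LinearMap.congr_fun hab y
  epi_g := by
    rw [ModuleCat.epi_iff_surjective]
    exact fun a => Module.Injective.extension_property R W _ _ _ (Submodule.injective_subtype _) a

omit [IsLocalRing R] in
theorem subsingleton_ext_of_injective (X : ModuleCat.{u} R) (W : Type u) [AddCommGroup W]
    [Module R W] [Module.Injective R W] (n : ℕ) :
    Subsingleton (Abelian.Ext.{u} X (ModuleCat.of R W) (n + 1)) :=
  have : Injective (ModuleCat.of R W) := Module.injective_object_of_injective_module R W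
  Abelian.Ext.subsingleton_of_injective X _ n

omit [IsLocalRing R] in
theorem subsingleton_ext_of_projective (P : Type u) [AddCommGroup P] [Module R P]
    [Module.Projective R P] (X : ModuleCat.{u} R) (n : ℕ) :
    Subsingleton (Abelian.Ext.{u} (ModuleCat.of R P) X (n + 1)) :=
  have : Projective (ModuleCat.of R P) := (IsProjective.iff_projective _).1 ‹_›
  Abelian.Ext.subsingleton_of_projective _ X n

/-- Duality between Bass numbers of the Matlis dual and Betti numbers. -/
theorem length_ext_linearMap_eq [IsNoetherianRing R] (W : Type u) [AddCommGroup W] [Module R W]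
    [Module.Injective R W]
    (hW : Module.length R (Abelian.Ext.{u} (residueFieldObj R) (ModuleCat.of R W) 0) = 1) (i : ℕ)
    (N : Type u) [AddCommGroup N] [Module R N] [Module.Finite R N] :
    Module.length R (Abelian.Ext.{u} (residueFieldObj R) (ModuleCat.of R (N →ₗ[R] W)) i) =
      Module.length R (Abelian.Ext.{u} (ModuleCat.of R N) (residueFieldObj R) i) := by
  -- Degree zero: Hom(k, Hom(N, W)) = Hom(N, Hom(k, W)), and Hom(k, W) ≅ k since it has length one.
  have h0 : ∀ (N : Type u) [AddCommGroup N] [Module R N],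
      Module.length R (Abelian.Ext.{u} (residueFieldObj R) (ModuleCat.of R (N →ₗ[R] W)) 0) =
      Module.length R (Abelian.Ext.{u} (ModuleCat.of R N) (residueFieldObj R) 0) := by
    intro N _ _
    rw [(Abelian.Ext.linearMapEquiv _ _).length_eq, Module.length_eq_one_iff] at hW
    obtain ⟨e⟩ := IsLocalRing.nonempty_linearEquiv_of_isSimpleModule (R := R)
      (ResidueField R →ₗ[R] W)
    let e' : (ResidueField R →ₗ[R] N →ₗ[R] W) ≃ₗ[R] (N →ₗ[R] ResidueField R →ₗ[R] W) :=
      { LinearMap.lflip (R₀ := R) with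
        invFun := fun g => g.flip
        left_inv := fun _ => rfl
        right_inv := fun _ => rfl }
    rw [(Abelian.Ext.linearMapEquiv _ _).length_eq, (Abelian.Ext.linearMapEquiv _ _).length_eq]
    exact (e'.trans (LinearEquiv.congrRight e)).length_eq
  induction i generalizing N with
  | zero => exact h0 N
  | succ i ih =>
    obtain ⟨P, _, _, _, _, f, hf⟩ := Module.exists_finite_presentation R N
    have hS := LinearMap.shortExact_shortComplexKer hf
    have hT := LinearMap.shortExact_shortComplexHom hf W
    have hI := Module.Injective.linearMap_of_projective (R := R) P W
    -- Hom(-, W) turns 0 → ker f → P → N → 0 into a sequence with injective middle term. Degree one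
    -- compares the two four-term sequences and cancels the finite length of Hom(P, k); higher
    -- degrees are pure dimension shifting.
    obtain _ | i := i
    · have h1 := Module.length_add_eq_of_exact _ _ _
        (Abelian.Ext.injective_postcomp_f hT (residueFieldObj R))
        (Abelian.Ext.exact_postcomp_f_g hT (residueFieldObj R) 0)
        (Abelian.Ext.exact_postcomp_g_δ hT (residueFieldObj R) 0) fun x =>
          (Abelian.Ext.exact_postcomp_δ_f hT (residueFieldObj R) 0 x).1
            ((subsingleton_ext_of_injective (residueFieldObj R) (P →ₗ[R] W) 0).elim _ _)
      have h2 := Module.length_add_eq_of_exact _ _ _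
        (Abelian.Ext.injective_precomp_g hS (residueFieldObj R))
        (Abelian.Ext.exact_precomp_g_f hS (residueFieldObj R) 0)
        (Abelian.Ext.exact_precomp_f_δ hS (residueFieldObj R) 0) fun x =>
          (Abelian.Ext.exact_precomp_δ_g hS (residueFieldObj R) 0 x).1
            ((subsingleton_ext_of_projective P (residueFieldObj R) 0).elim _ _)
      have h3 := (congrArg₂ (· + ·) (h0 N) (h0 (LinearMap.ker f))).trans h2.symm
      have h4 := (congrArg (· + _) (h0 P)).symm.trans (h1.trans h3)
      exact ENat.add_right_injective_of_ne_top (length_ext_residueField_ne_top P 0) h4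
    · have e1 := Abelian.Ext.shiftEquiv hT (residueFieldObj R) (i + 1)
        (subsingleton_ext_of_injective _ _ i) (subsingleton_ext_of_injective _ _ (i + 1))
      have e2 := Abelian.Ext.shiftEquivLeft hS (residueFieldObj R) (i + 1)
        (subsingleton_ext_of_projective P _ i) (subsingleton_ext_of_projective P _ (i + 1))
      exact (e1.length_eq.symm.trans (ih (LinearMap.ker f))).trans e2.length_eq

end MatlisDual

/-! ### The Artinian case -/

section ArtinianDuality

variable {R : Type u} [CommRing R]

theorem LinearMap.injective_of_surjective_of_length_eq {A B : Type*} [AddCommGroup A]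
    [AddCommGroup B] [Module R A] [Module R B] (f : A →ₗ[R] B) (hf : Function.Surjective f)
    (h : Module.length R A = Module.length R B) (hB : Module.length R A ≠ ⊤) :
    Function.Injective f := by
  have h1 := Module.length_eq_add_of_exact (LinearMap.ker f).subtype f
    (Submodule.injective_subtype _) hf (LinearMap.exact_subtype_ker_map f)
  rw [← h, add_comm] at h1
  have h2 : Module.length R (LinearMap.ker f) = 0 :=
    ENat.add_right_injective_of_ne_top (by simpa using hB) (by
      change Module.length R A + _ = Module.length R A + 0
      rw [← h1, add_zero])
  rw [Module.length_eq_zero_iff, Submodule.subsingleton_iff_eq_bot] at h2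
  exact LinearMap.ker_eq_bot.1 h2

/-- Homomorphisms out of a cyclic module whose annihilator kills the target. -/
def Ideal.quotientHomEquiv (J : Ideal R) (N : Type u) [AddCommGroup N] [Module R N]
    (h : ∀ r ∈ J, ∀ x : N, r • x = 0) : ((R ⧸ J) →ₗ[R] N) ≃ₗ[R] N :=
  LinearEquiv.ofBijective (LinearMap.applyₗ (1 : R ⧸ J)) <| by
    refine ⟨fun f g hfg => ?_, fun x => ⟨J.liftQ (LinearMap.toSpanSingleton R N x) ?_, ?_⟩⟩
    · refine Submodule.linearMap_qext _ (LinearMap.ext_ring ?_)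
      exact hfg
    · intro r hr
      exact h r hr x
    · change (1 : R) • x = x
      exact one_smul R x

variable [IsLocalRing R]

theorem exists_nonzero_residueField_hom {K : Type u} [AddCommGroup K] [Module R K] [Nontrivial K]
    (hK : IsFiniteLength R K) : ∃ f : ResidueField R →ₗ[R] K, f ≠ 0 := by
  have := (isFiniteLength_iff_isNoetherian_isArtinian.1 hK).2
  obtain ⟨S, hS⟩ := IsAtomic.exists_atom (Submodule R K)
  have hS' : IsSimpleModule R S := isSimpleModule_iff_isAtom.2 hS
  obtain ⟨e⟩ := IsLocalRing.nonempty_linearEquiv_of_isSimpleModule (R := R) S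
  refine ⟨S.subtype ∘ₗ e.symm.toLinearMap, fun h0 => one_ne_zero (α := ResidueField R) ?_⟩
  have h1 := LinearMap.congr_fun h0 1
  exact e.symm.injective (Subtype.ext h1 |>.trans (map_zero _).symm)

/-- An embedding into an injective module whose socle is the residue field. -/
theorem exists_injective_linearMap {N W : Type u} [AddCommGroup N] [Module R N] [AddCommGroup W]
    [Module R W] [Module.Injective R W] (hNf : IsFiniteLength R N)
    (hN : Module.length R (Abelian.Ext.{u} (residueFieldObj R) (ModuleCat.of R N) 0) = 1)
    (hW : Module.length R (Abelian.Ext.{u} (residueFieldObj R) (ModuleCat.of R W) 0) = 1) :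
    ∃ g : N →ₗ[R] W, Function.Injective g := by
  rw [(Abelian.Ext.linearMapEquiv _ _).length_eq, Module.length_eq_one_iff] at hN hW
  have := hN.nontrivial
  have := hW.nontrivial
  obtain ⟨f, hf⟩ := exists_ne (0 : ResidueField R →ₗ[R] N)
  obtain ⟨f', hf'⟩ := exists_ne (0 : ResidueField R →ₗ[R] W)
  have hfi : Function.Injective f := (LinearMap.injective_or_eq_zero f).resolve_right hf
  obtain ⟨g, hg⟩ := Module.Injective.extension_property R W _ _ f hfi f'
  refine ⟨g, LinearMap.ker_eq_bot.1 ?_⟩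
  by_contra hK
  have : Nontrivial (LinearMap.ker g) := Submodule.nontrivial_iff_ne_bot.2 hK
  obtain ⟨h, hh⟩ := exists_nonzero_residueField_hom (R := R) (K := LinearMap.ker g)
    (hNf.of_injective (Submodule.injective_subtype _))
  -- Hom(k, N) is simple and `g` does not kill `f`, so `g` is injective on maps from k; this
  -- contradicts a nonzero map k → ker g.
  have hinj := (LinearMap.injective_or_eq_zero
    (LinearMap.llcomp R (ResidueField R) N W g)).resolve_right fun h0 =>
      hf' (hg.symm.trans (LinearMap.congr_fun h0 f))
  refine hh (LinearMap.ext fun x => Subtype.ext ?_)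
  refine LinearMap.congr_fun (f := (LinearMap.ker g).subtype ∘ₗ h) (g := 0) (hinj ?_) x
  rw [map_zero]
  exact LinearMap.ext fun y => (h y).2

/-- The hypothesis `h` makes `N` a canonical module of R/J as far as lengths can see. It forces N to
be faithful over R/J with socle k, so that R/J is the Matlis dual of N. -/
theorem length_ext_quotient_eq [IsNoetherianRing R] {J : Ideal R} (hJm : J ≤ maximalIdeal R)
    (hJ : IsFiniteLength R (R ⧸ J)) (N : Type u) [AddCommGroup N] [Module R N] [Module.Finite R N]
    (hN : ∀ r ∈ J, ∀ x : N, r • x = 0)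
    (h : ∀ (X : Type u) [AddCommGroup X] [Module R X], IsFiniteLength R X →
      (∀ r ∈ J, ∀ x : X, r • x = 0) →
      Module.length R (Abelian.Ext.{u} (ModuleCat.of R X) (ModuleCat.of R N) 0) =
        Module.length R X) (i : ℕ) :
    Module.length R (Abelian.Ext.{u} (residueFieldObj R) (ModuleCat.of R (R ⧸ J)) i) =
      Module.length R (Abelian.Ext.{u} (ModuleCat.of R N) (residueFieldObj R) i) := by
  obtain ⟨W, _, _, hWi, hW⟩ := exists_injective_hull_residueField R
  have hNf := isFiniteLength_of_smul_eq_zero hJ N hN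
  have hkill : ∀ (A : Ideal R), J ≤ A → ∀ r ∈ J, ∀ x : R ⧸ A, r • x = 0 := by
    intro A hA r hr x
    obtain ⟨y, rfl⟩ := Submodule.Quotient.mk_surjective _ x
    rw [← Submodule.Quotient.mk_smul, Submodule.Quotient.mk_eq_zero]
    exact Ideal.mul_mem_right y A (hA hr)
  have hlen : ∀ (A : Ideal R), J ≤ A → (∀ r ∈ A, ∀ x : N, r • x = 0) →
      Module.length R (R ⧸ A) = Module.length R N := by
    intro A hA hAN
    rw [← h (R ⧸ A) (hJ.of_surjective (Submodule.factor_surjective hA)) (hkill A hA),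
      (Abelian.Ext.linearMapEquiv _ _).length_eq, (A.quotientHomEquiv N hAN).length_eq]
  -- R/J and R/Ann(N) both have the length of N, since Hom out of either into N is N; the surjection
  -- between them is thus injective.
  have hann : ∀ r, (∀ x : N, r • x = 0) → r ∈ J := by
    intro r hr
    have hle : J ≤ Module.annihilator R N := fun a ha => Module.mem_annihilator.2 (hN a ha)
    have hinj := LinearMap.injective_of_surjective_of_length_eq (Submodule.factor hle)
      (Submodule.factor_surjective hle)
      ((hlen J le_rfl hN).trans (hlen _ hle fun a ha => Module.mem_annihilator.1 ha).symm)
      (Module.length_ne_top_iff.2 hJ)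
    refine (Submodule.Quotient.mk_eq_zero J).1 (hinj ?_)
    rw [map_zero]
    exact (Submodule.Quotient.mk_eq_zero _).2 (Module.mem_annihilator.2 hr)
  obtain ⟨g, hg⟩ := exists_injective_linearMap hNf
    ((h (ResidueField R) isFiniteLength_residueField fun r hr =>
      smul_residueField_eq_zero R (hJm hr)).trans (Module.length_eq_one _ _)) hW
  -- The map 1 ↦ g. It is injective because `g` is an embedding and N is faithful over R/J.
  let φ : (R ⧸ J) →ₗ[R] (N →ₗ[R] W) := J.liftQ (LinearMap.toSpanSingleton R _ g) (by
    intro r hr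
    refine LinearMap.ext fun x => ?_
    change r • g x = 0
    rw [← map_smul, hN r hr, map_zero])
  have hφ : Function.Injective φ := by
    refine (injective_iff_map_eq_zero _).2 fun y hy => ?_
    obtain ⟨r, rfl⟩ := Submodule.Quotient.mk_surjective _ y
    refine (Submodule.Quotient.mk_eq_zero J).2 (hann r fun x => hg ?_)
    rw [map_zero, map_smul]
    exact LinearMap.congr_fun hy x
  -- Hom(-, W) preserves finite lengths, so Hom(N, W) has the length of N, which is that of R/J.
  have hφb := LinearMap.bijective_of_injective_of_length_eq φ hφ (by
    rw [hlen J le_rfl hN, ← (Abelian.Ext.linearMapEquiv _ _).length_eq]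
    exact (length_ext_of_isFiniteLength (V := ModuleCat.of R W) (s := 0)
      (fun j hj => absurd hj (Nat.succ_ne_zero j)) (subsingleton_ext_of_injective _ W 0)
      hW hNf).symm) (Module.length_ne_top_iff.2 hJ)
  rw [← length_ext_linearMap_eq W hW i N]
  exact (Abelian.Ext.congrRight _ (LinearEquiv.ofBijective φ hφb).toModuleIso i).length_eq

end ArtinianDuality

/-! ### Ext modulo a regular element -/

section RegularElement

variable {R : Type u} [CommRing R]

theorem mk₀_smulShortComplex_postcomp {X M : ModuleCat.{u} R} {x : R} {n : ℕ}
    (e : Abelian.Ext.{u} X M n) :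
    (Abelian.Ext.mk₀ (M.smulShortComplex x).f).postcompOfLinear R X (add_zero n) e = x • e := by
  change e.comp (Abelian.Ext.mk₀ (x • 𝟙 M)) (add_zero n) = x • e
  rw [Abelian.Ext.mk₀_smul, Abelian.Ext.comp_smul, Abelian.Ext.comp_mk₀_id]

theorem mk₀_smulShortComplex_precomp {X M : ModuleCat.{u} R} {x : R} {n : ℕ}
    (e : Abelian.Ext.{u} M X n) :
    (Abelian.Ext.mk₀ (M.smulShortComplex x).f).precompOfLinear R X (zero_add n) e = x • e := by
  change (Abelian.Ext.mk₀ (x • 𝟙 M)).comp e (zero_add n) = x • e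
  rw [Abelian.Ext.mk₀_smul, Abelian.Ext.smul_comp, Abelian.Ext.mk₀_id_comp]

variable {x : R} {M : Type u} [AddCommGroup M] [Module R M]

theorem subsingleton_ext_quotSMulTop (hx : IsSMulRegular M x) {X : ModuleCat.{u} R} {n : ℕ}
    (h : Subsingleton (Abelian.Ext.{u} X (ModuleCat.of R M) n))
    (h' : Subsingleton (Abelian.Ext.{u} X (ModuleCat.of R M) (n + 1))) :
    Subsingleton (Abelian.Ext.{u} X (ModuleCat.of R (QuotSMulTop x M)) n) :=
  Abelian.Ext.subsingleton_trd (S := (ModuleCat.of R M).smulShortComplex x)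
    (IsSMulRegular.smulShortComplex_shortExact (M := ModuleCat.of R M) hx) h h'

/-- Rees: `Ext^n(X, M / xM) = Ext^{n+1}(X, M)` if `x` kills `X` and `Ext^n(X, M) = 0`. -/
theorem length_ext_quotSMulTop_eq (hx : IsSMulRegular M x) {X : ModuleCat.{u} R}
    (hX : ∀ y : X, x • y = 0) {n : ℕ}
    (h : Subsingleton (Abelian.Ext.{u} X (ModuleCat.of R M) n)) :
    Module.length R (Abelian.Ext.{u} X (ModuleCat.of R (QuotSMulTop x M)) n) =
      Module.length R (Abelian.Ext.{u} X (ModuleCat.of R M) (n + 1)) := by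
  have hS : ((ModuleCat.of R M).smulShortComplex x).ShortExact :=
    IsSMulRegular.smulShortComplex_shortExact (M := ModuleCat.of R M) hx
  refine (LinearEquiv.ofBijective
    (hS.extClass.postcompOfLinear R X (rfl : n + 1 = n + 1)) ⟨?_, fun y => ?_⟩).length_eq
  · refine (injective_iff_map_eq_zero _).2 fun y hy => ?_
    obtain ⟨z, rfl⟩ := (Abelian.Ext.exact_postcomp_g_δ hS X n y).1 hy
    have hz : z = 0 := h.elim _ _
    rw [hz, map_zero]
  · refine (Abelian.Ext.exact_postcomp_δ_f hS X n y).1 ?_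
    exact (mk₀_smulShortComplex_postcomp (M := ModuleCat.of R M) _).trans
      (Abelian.Ext.smul_eq_zero_of_left hX _)

/-- Since `x` kills X, multiplication by `x` is zero on Ext(X, M), and the long exact sequence
breaks into short exact ones. -/
theorem length_ext_quotSMulTop (hx : IsSMulRegular M x) {X : ModuleCat.{u} R}
    (hX : ∀ y : X, x • y = 0) (n : ℕ) :
    Module.length R (Abelian.Ext.{u} X (ModuleCat.of R (QuotSMulTop x M)) n) =
      Module.length R (Abelian.Ext.{u} X (ModuleCat.of R M) n) +
        Module.length R (Abelian.Ext.{u} X (ModuleCat.of R M) (n + 1)) := by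
  have hS : ((ModuleCat.of R M).smulShortComplex x).ShortExact :=
    IsSMulRegular.smulShortComplex_shortExact (M := ModuleCat.of R M) hx
  refine Module.length_eq_add_of_exact
    ((Abelian.Ext.mk₀ ((ModuleCat.of R M).smulShortComplex x).g).postcompOfLinear R X (add_zero n))
    (hS.extClass.postcompOfLinear R X (rfl : n + 1 = n + 1)) ?_ (fun y => ?_)
    (Abelian.Ext.exact_postcomp_g_δ hS X n)
  · refine (injective_iff_map_eq_zero _).2 fun y hy => ?_
    obtain ⟨z, rfl⟩ := (Abelian.Ext.exact_postcomp_f_g hS X n y).1 hy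
    exact (mk₀_smulShortComplex_postcomp (M := ModuleCat.of R M) _).trans
      (Abelian.Ext.smul_eq_zero_of_left hX _)
  · refine (Abelian.Ext.exact_postcomp_δ_f hS X n y).1 ?_
    exact (mk₀_smulShortComplex_postcomp (M := ModuleCat.of R M) _).trans
      (Abelian.Ext.smul_eq_zero_of_left hX _)

theorem length_quotSMulTop_ext_zero {X : ModuleCat.{u} R}
    (hx : IsSMulRegular M x) (hX : ∀ y : X, x • y = 0) :
    Module.length R (Abelian.Ext.{u} (ModuleCat.of R (QuotSMulTop x M)) X 0) =
      Module.length R (Abelian.Ext.{u} (ModuleCat.of R M) X 0) := by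
  have hS : ((ModuleCat.of R M).smulShortComplex x).ShortExact :=
    IsSMulRegular.smulShortComplex_shortExact (M := ModuleCat.of R M) hx
  refine (LinearEquiv.ofBijective ((Abelian.Ext.mk₀
    ((ModuleCat.of R M).smulShortComplex x).g).precompOfLinear R X (zero_add 0))
    ⟨Abelian.Ext.injective_precomp_g hS X, fun y => ?_⟩).length_eq
  refine (Abelian.Ext.exact_precomp_g_f hS X 0 y).1 ?_
  exact (mk₀_smulShortComplex_precomp (M := ModuleCat.of R M) _).trans
    (Abelian.Ext.smul_eq_zero_of_right hX _)

/-- The contravariant counterpart of the same splitting: `x` acts as zero on Ext(M, X). -/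
theorem length_quotSMulTop_ext_succ {X : ModuleCat.{u} R}
    (hx : IsSMulRegular M x) (hX : ∀ y : X, x • y = 0) (n : ℕ) :
    Module.length R (Abelian.Ext.{u} (ModuleCat.of R (QuotSMulTop x M)) X (n + 1)) =
      Module.length R (Abelian.Ext.{u} (ModuleCat.of R M) X n) +
        Module.length R (Abelian.Ext.{u} (ModuleCat.of R M) X (n + 1)) := by
  have hS : ((ModuleCat.of R M).smulShortComplex x).ShortExact :=
    IsSMulRegular.smulShortComplex_shortExact (M := ModuleCat.of R M) hx
  refine Module.length_eq_add_of_exact (hS.extClass.precompOfLinear R X (add_comm 1 n))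
    ((Abelian.Ext.mk₀ ((ModuleCat.of R M).smulShortComplex x).g).precompOfLinear R X
      (zero_add (n + 1))) ?_ (fun y => ?_) (Abelian.Ext.exact_precomp_δ_g hS X n)
  · refine (injective_iff_map_eq_zero _).2 fun y hy => ?_
    obtain ⟨z, rfl⟩ := (Abelian.Ext.exact_precomp_f_δ hS X n y).1 hy
    exact (mk₀_smulShortComplex_precomp (M := ModuleCat.of R M) _).trans
      (Abelian.Ext.smul_eq_zero_of_right hX _)
  · refine (Abelian.Ext.exact_precomp_g_f hS X (n + 1) y).1 ?_
    exact (mk₀_smulShortComplex_precomp (M := ModuleCat.of R M) _).trans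
      (Abelian.Ext.smul_eq_zero_of_right hX _)

end RegularElement

/-! ### Dimension and regular elements -/

section FiniteLength

variable {R : Type u} [CommRing R] [IsNoetherianRing R]

/-- R/Ann(M) is Noetherian of dimension at most zero, hence Artinian, and M is finite over it. -/
theorem isFiniteLength_of_supportDim_le_zero (M : Type u) [AddCommGroup M] [Module R M]
    [Module.Finite R M] (h : Module.supportDim R M ≤ 0) : IsFiniteLength R M := by
  refine isFiniteLength_of_smul_eq_zero (J := Module.annihilator R M) ?_ M
    fun r hr x => Module.mem_annihilator.1 hr x
  rw [Module.supportDim_eq_ringKrullDim_quotient_annihilator] at h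
  have : Ring.KrullDimLE 0 (R ⧸ Module.annihilator R M) := Ring.krullDimLE_iff.2 h
  have : IsArtinianRing (R ⧸ Module.annihilator R M) :=
    IsNoetherianRing.isArtinianRing_of_krullDimLE_zero
  refine isFiniteLength_iff_isNoetherian_isArtinian.2 ⟨inferInstance, ?_⟩
  exact isArtinian_of_surjective_algebraMap (R := R ⧸ Module.annihilator R M)
    Ideal.Quotient.mk_surjective

variable [IsLocalRing R]

theorem supportDim_quotSMulTop_le {M : Type u} [AddCommGroup M] [Module R M] [Module.Finite R M]
    {x : R} (hx : IsSMulRegular M x) (hxm : x ∈ maximalIdeal R) {s : ℕ}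
    (h : Module.supportDim R M ≤ (s + 1 : ℕ)) :
    Module.supportDim R (QuotSMulTop x M) ≤ s := by
  rw [← Module.supportDim_quotSMulTop_succ_eq_supportDim (R := R) (M := M) hx hxm, Nat.cast_add, Nat.cast_one] at h
  rw [← Nat.cast_one (R := WithBot ℕ∞)] at h
  exact ENat.WithBot.add_le_add_natCast_right_iff.1 h

/-- If `Hom(k, M) = Hom(k, N) = 0`, some element of the maximal ideal is regular on both. -/
theorem exists_isSMulRegular_pair (M N : Type u) [AddCommGroup M] [Module R M] [Module.Finite R M]
    [AddCommGroup N] [Module R N] [Module.Finite R N]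
    (hM : Subsingleton (Abelian.Ext.{u} (residueFieldObj R) (ModuleCat.of R M) 0))
    (hN : Subsingleton (Abelian.Ext.{u} (residueFieldObj R) (ModuleCat.of R N) 0)) :
    ∃ x ∈ maximalIdeal R, IsSMulRegular M x ∧ IsSMulRegular N x := by
  have hM' := (Abelian.Ext.linearMapEquiv (R := R) (ResidueField R) M).symm.subsingleton
  have hN' := (Abelian.Ext.linearMapEquiv (R := R) (ResidueField R) N).symm.subsingleton
  -- The criterion for one module, applied to the product, yields one element regular on both
  -- factors.
  have : Subsingleton (ResidueField R →ₗ[R] M × N) :=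
    ⟨fun f g => LinearMap.ext fun a => Prod.ext
      (LinearMap.congr_fun (hM'.elim (LinearMap.fst R M N ∘ₗ f) (LinearMap.fst R M N ∘ₗ g)) a)
      (LinearMap.congr_fun (hN'.elim (LinearMap.snd R M N ∘ₗ f) (LinearMap.snd R M N ∘ₗ g)) a)⟩
  obtain ⟨x, hx, hreg⟩ := IsSMulRegular.subsingleton_linearMap_iff (R := R).1 this
  refine ⟨x, ?_, fun a b hab => ?_, fun a b hab => ?_⟩
  · rw [← residue_eq_zero_iff, ← ResidueField.algebraMap_eq, ← mul_one (algebraMap _ _ x),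
      ← Algebra.smul_def]
    exact Module.mem_annihilator.1 hx 1
  · exact congrArg Prod.fst (hreg (a₁ := (a, 0)) (a₂ := (b, 0)) (Prod.ext hab rfl))
  · exact congrArg Prod.snd (hreg (a₁ := (0, a)) (a₂ := (0, b)) (Prod.ext rfl hab))

end FiniteLength

/-! ### Reduction to the Artinian case; injective dimension -/

section Main

variable {R : Type u} [CommRing R] [IsLocalRing R] [IsNoetherianRing R]

/-- Bass numbers of a cyclic Cohen-Macaulay module against Betti numbers of a module that
behaves like its canonical module. -/
theorem length_ext_add_eq (s : ℕ) (M N : Type u) [AddCommGroup M] [Module R M] [Module.Finite R M]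
    [AddCommGroup N] [Module R N] [Module.Finite R N] (π : R →ₗ[R] M) (hπ : Function.Surjective π)
    (hπm : LinearMap.ker π ≤ maximalIdeal R) (hπN : ∀ r ∈ LinearMap.ker π, ∀ y : N, r • y = 0)
    (hM : ∀ j < s, Subsingleton (Abelian.Ext.{u} (residueFieldObj R) (ModuleCat.of R M) j))
    (hN : ∀ j < s, Subsingleton (Abelian.Ext.{u} (residueFieldObj R) (ModuleCat.of R N) j))
    (hdim : Module.supportDim R M ≤ s)
    (h : ∀ (X : Type u) [AddCommGroup X] [Module R X], IsFiniteLength R X →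
      (∀ r ∈ LinearMap.ker π, ∀ x : X, r • x = 0) →
      Module.length R (Abelian.Ext.{u} (ModuleCat.of R X) (ModuleCat.of R N) s) =
        Module.length R X) (i : ℕ) :
    Module.length R (Abelian.Ext.{u} (residueFieldObj R) (ModuleCat.of R M) (s + i)) =
      Module.length R (Abelian.Ext.{u} (ModuleCat.of R N) (residueFieldObj R) i) := by
  induction s generalizing M N i with
  | zero =>
    have hf : IsFiniteLength R M := isFiniteLength_of_supportDim_le_zero M hdim
    let e := π.quotKerEquivOfSurjective hπ
    rw [zero_add, ← length_ext_quotient_eq hπm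
      (e.symm.isFiniteLength hf) N hπN h i]
    exact (Abelian.Ext.congrRight _ e.symm.toModuleIso i).length_eq
  | succ s ih =>
    obtain ⟨x, hxm, hxM, hxN⟩ := exists_isSMulRegular_pair M N
      (hM 0 (Nat.succ_pos s)) (hN 0 (Nat.succ_pos s))
    have hk : ∀ y : residueFieldObj R, x • y = 0 := smul_residueField_eq_zero R hxm
    -- The quotient M/xM is again cyclic, with annihilator ker π + (x), so the induction stays among
    -- cyclic modules and its test modules X are exactly those killed by ker π and by x.
    have hker : LinearMap.ker ((x • (⊤ : Submodule R M)).mkQ ∘ₗ π) =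
        LinearMap.ker π ⊔ Ideal.span {x} := by
      ext r
      rw [LinearMap.mem_ker, LinearMap.comp_apply, Submodule.mkQ_apply,
        Submodule.Quotient.mk_eq_zero, Submodule.mem_smul_pointwise_iff_exists,
        Submodule.mem_sup]
      constructor
      · rintro ⟨m, -, hm⟩
        obtain ⟨t, rfl⟩ := hπ m
        refine ⟨r - t * x, ?_, t * x, Ideal.mul_mem_left _ t (Ideal.mem_span_singleton_self x),
          by ring⟩
        rw [LinearMap.mem_ker, map_sub, ← hm, mul_comm, ← smul_eq_mul, map_smul, sub_self]
      · rintro ⟨a, ha, b, hb, rfl⟩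
        obtain ⟨t, rfl⟩ := Ideal.mem_span_singleton'.1 hb
        refine ⟨π t, trivial, ?_⟩
        rw [map_add, LinearMap.mem_ker.1 ha, zero_add, mul_comm, ← smul_eq_mul, map_smul]
    have hkill : ∀ {X : Type u} [AddCommGroup X] [Module R X],
        (∀ r ∈ LinearMap.ker π ⊔ Ideal.span {x}, ∀ y : X, r • y = 0) ↔
          (∀ r ∈ LinearMap.ker π, ∀ y : X, r • y = 0) ∧ ∀ y : X, x • y = 0 := by
      intro X _ _
      refine ⟨fun hX => ⟨fun r hr => hX r (Submodule.mem_sup_left hr),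
        hX x (Submodule.mem_sup_right (Ideal.mem_span_singleton_self x))⟩, ?_⟩
      rintro ⟨h1, h2⟩ r hr y
      obtain ⟨a, ha, b, hb, rfl⟩ := Submodule.mem_sup.1 hr
      obtain ⟨t, rfl⟩ := Ideal.mem_span_singleton'.1 hb
      rw [add_smul, h1 a ha, mul_smul, h2, smul_zero, add_zero]
    have key := ih (QuotSMulTop x M) (QuotSMulTop x N) ((x • (⊤ : Submodule R M)).mkQ ∘ₗ π)
      ((Submodule.mkQ_surjective _).comp hπ)
      (by
        rw [hker]
        exact sup_le hπm ((Ideal.span_singleton_le_iff_mem _).2 hxm))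
      (by
        rw [hker, hkill]
        refine ⟨fun r hr y => ?_, fun y => ?_⟩
        · obtain ⟨y, rfl⟩ := Submodule.mkQ_surjective _ y
          rw [← map_smul, hπN r hr, map_zero]
        · obtain ⟨y, rfl⟩ := Submodule.mkQ_surjective _ y
          rw [← map_smul, Submodule.mkQ_apply, Submodule.Quotient.mk_eq_zero]
          exact Submodule.smul_mem_pointwise_smul y x _ trivial)
      (fun j hj => subsingleton_ext_quotSMulTop hxM (hM j (hj.trans (Nat.lt_succ_self s)))
        (hM (j + 1) (Nat.succ_lt_succ hj)))
      (fun j hj => subsingleton_ext_quotSMulTop hxN (hN j (hj.trans (Nat.lt_succ_self s)))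
        (hN (j + 1) (Nat.succ_lt_succ hj)))
      (supportDim_quotSMulTop_le hxM hxm hdim)
      (by
        intro X _ _ hX hXk
        rw [hker, hkill] at hXk
        -- By Rees, Ext^s(X, N/xN) ≅ Ext^{s+1}(X, N) because Ext^s(X, N) = 0, so the length
        -- hypothesis descends to N/xN.
        rw [length_ext_quotSMulTop_eq hxN (X := ModuleCat.of R X) hXk.2
          (subsingleton_ext_of_isFiniteLength (hN s (Nat.lt_succ_self s)) hX), h X hX hXk.1])
    -- Writing μ and β for the two sides, `key` reads μ_{s+i} + μ_{s+i+1} = β_{i-1} + β_i, with μ_s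
    -- = 0 and β_{-1} = 0. Cancelling the finite term β_{i-1} passes from one i to the next.
    induction i with
    | zero =>
      have h1 := key 0
      rw [length_ext_quotSMulTop hxM hk, length_quotSMulTop_ext_zero hxN hk,
        Module.length_eq_zero_iff.2 (hM (s + 0) (Nat.lt_succ_self s)), zero_add] at h1
      exact h1
    | succ i ihi =>
      have h1 := key (i + 1)
      rw [length_ext_quotSMulTop hxM hk, length_quotSMulTop_ext_succ hxN hk] at h1
      rw [Nat.succ_add_eq_add_succ] at ihi ⊢
      rw [ihi] at h1
      exact ENat.add_right_injective_of_ne_top (length_ext_residueField_ne_top N i) h1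

/-- Over a Cohen-Macaulay local ring, `Ext^i(k, V)` vanishes above the dimension when `V` has
finite injective dimension. -/
theorem subsingleton_ext_of_hasInjectiveDimensionLE {rs : List R}
    (hreg : RingTheory.Sequence.IsRegular R rs) (hrs : ∀ r ∈ rs, r ∈ maximalIdeal R)
    (hdim : ringKrullDim R = rs.length) {V : ModuleCat.{u} R} {n : ℕ}
    [HasInjectiveDimensionLE V n] (i : ℕ) (hi : rs.length < i) :
    Subsingleton (Abelian.Ext.{u} (residueFieldObj R) V i) := by
  -- `A` is R modulo a maximal regular sequence: of finite length, so it contains k, and of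
  -- projective dimension at most the length of `rs`.
  let A := R ⧸ Ideal.ofList rs • (⊤ : Submodule R R)
  have hA : Nontrivial A := Submodule.Quotient.nontrivial_iff.2 hreg.2.symm
  have hpd : projectiveDimension (ModuleCat.of R A) ≤ rs.length := by
    have h1 := ModuleCat.projectiveDimension_quotient_eq_add_length_of_isWeaklyRegular
      (ModuleCat.of R R) rs hreg.1 hrs
    have h2 : projectiveDimension (ModuleCat.of R R) = 0 :=
      ModuleCat.projectiveDimension_eq_zero_of_projective (ModuleCat.of R R)
    rw [h2, zero_add] at h1
    exact h1.le
  have hpd' := (projectiveDimension_le_iff _ _).1 hpd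
  have hAf : IsFiniteLength R A := by
    refine isFiniteLength_of_supportDim_le_zero A ?_
    have h1 := Module.supportDim_add_length_eq_supportDim_of_isRegular (M := R) rs hreg
    rw [Module.supportDim_self_eq_ringKrullDim, hdim] at h1
    have h2 : Module.supportDim R A + (rs.length : ℕ) ≤ 0 + (rs.length : ℕ) := by
      rw [zero_add]
      exact h1.le
    exact ENat.WithBot.add_le_add_natCast_right_iff.1 h2
  obtain ⟨f, hf⟩ := exists_nonzero_residueField_hom hAf
  have hfi : Function.Injective f := (LinearMap.injective_or_eq_zero f).resolve_right hf
  have hS := (LinearMap.range f).shortExact_mkQ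
  have e : residueFieldObj R ≅ ModuleCat.of R (LinearMap.range f) :=
    (LinearEquiv.ofInjective f hfi).toModuleIso
  have hC : IsFiniteLength R (A ⧸ LinearMap.range f) :=
    hAf.of_surjective (Submodule.mkQ_surjective _)
  -- Descending induction on i from beyond the injective dimension: Ext^i(k, V) lies between
  -- Ext^i(A, V) = 0 and Ext^{i+1}(A/k, V), which vanishes by dévissage from degree i + 1.
  suffices H : ∀ m i, rs.length < i → n < i + m →
      Subsingleton (Abelian.Ext.{u} (residueFieldObj R) V i) from
    H (n + 1) i hi (by lia)
  intro m
  induction m with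
  | zero =>
    intro i _ hn
    exact HasInjectiveDimensionLT.subsingleton V (n + 1) i (by lia) _
  | succ m ihm =>
    intro i hi hn
    have h3 := subsingleton_ext_of_isFiniteLength (ihm (i + 1) (by lia) (by lia)) hC
    have h2 : Subsingleton (Abelian.Ext.{u} (ModuleCat.of R A) V i) :=
      HasProjectiveDimensionLT.subsingleton (ModuleCat.of R A) (rs.length + 1) i hi V
    have h1 := Abelian.Ext.subsingleton_fst_left hS h2 h3
    exact (Abelian.Ext.congrLeft e V i).symm.subsingleton

end Main

/-! ### The direct system Ext^j(R/I^n, M) -/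

section QuotientPowers

variable {R : Type u} [CommRing R] (I : Ideal R)

/-- The module `R / I ^ n`. -/
abbrev quotPow (n : ℕ) : ModuleCat.{u} R := ModuleCat.of R (R ⧸ I ^ n)

/-- The transition map `R / I ^ n' ⟶ R / I ^ n`. -/
abbrev quotPowMap {n n' : ℕ} (h : n ≤ n') : quotPow I n' ⟶ quotPow I n :=
  ModuleCat.ofHom (Submodule.mapQ _ _ LinearMap.id (Ideal.pow_le_pow_right h))

theorem quotPowMap_comp {n n' n'' : ℕ} (h : n ≤ n') (h' : n' ≤ n'') :
    quotPowMap I h' ≫ quotPowMap I h = quotPowMap I (h.trans h') := by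
  ext
  rfl

variable {I}

/-- The transition map `Ext^j(R / I ^ n, M) → Ext^j(R / I ^ n', M)`. -/
def extRestrict {M : ModuleCat.{u} R} {j n n' : ℕ} (h : n ≤ n') :
    Abelian.Ext.{u} (quotPow I n) M j →ₗ[R] Abelian.Ext.{u} (quotPow I n') M j :=
  (Abelian.Ext.mk₀ (quotPowMap I h)).precompOfLinear R M (zero_add j)

theorem extRestrict_apply {M : ModuleCat.{u} R} {j n n' : ℕ} (h : n ≤ n')
    (x : Abelian.Ext.{u} (quotPow I n) M j) :
    extRestrict h x = (Abelian.Ext.mk₀ (quotPowMap I h)).comp x (zero_add j) := rfl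

theorem extRestrict_extRestrict {M : ModuleCat.{u} R} {j n n' n'' : ℕ} (h : n ≤ n')
    (h' : n' ≤ n'') (x : Abelian.Ext.{u} (quotPow I n) M j) :
    extRestrict h' (extRestrict h x) = extRestrict (h.trans h') x := by
  rw [extRestrict_apply, extRestrict_apply, extRestrict_apply, ← quotPowMap_comp I h h',
    Abelian.Ext.mk₀_comp_mk₀_assoc]

theorem extRestrict_comp {M N : ModuleCat.{u} R} {j l j' n n' : ℕ} (h : n ≤ n')
    (x : Abelian.Ext.{u} (quotPow I n) M j) (β : Abelian.Ext.{u} M N l) (hj : j + l = j') :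
    extRestrict h (x.comp β hj) = (extRestrict h x).comp β hj := by
  rw [extRestrict_apply, extRestrict_apply, Abelian.Ext.comp_assoc _ _ _ _ _ (by lia)]

theorem extRestrict_mk₀ {M : ModuleCat.{u} R} {n n' : ℕ} (h : n ≤ n') (f : quotPow I n ⟶ M) :
    extRestrict h (Abelian.Ext.mk₀ f) = Abelian.Ext.mk₀ (quotPowMap I h ≫ f) := by
  rw [extRestrict_apply, Abelian.Ext.mk₀_comp_mk₀]

variable (I)

/-- Every class in `Ext^j(R / I ^ n, M)` dies in some `Ext^j(R / I ^ n', M)`; that is, the `j`-th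
local cohomology of `M` vanishes. -/
def ExtEventuallyZero (M : ModuleCat.{u} R) (j : ℕ) : Prop :=
  ∀ (n : ℕ) (x : Abelian.Ext.{u} (quotPow I n) M j), ∃ (n' : ℕ) (h : n ≤ n'), extRestrict h x = 0

variable {I}

theorem ExtEventuallyZero.of_subsingleton {M : ModuleCat.{u} R} {j : ℕ}
    (h : ∀ n, Subsingleton (Abelian.Ext.{u} (quotPow I n) M j)) : ExtEventuallyZero I M j :=
  fun n _ => ⟨n, le_rfl, (h n).elim _ _⟩

/-- Exactness of filtered colimits done on elements: restrict until the image under the connecting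
map dies, lift to `S.X₂`, then restrict until the lift dies. -/
theorem ExtEventuallyZero.trd {S : ShortComplex (ModuleCat.{u} R)} (hS : S.ShortExact) {j : ℕ}
    (h₂ : ExtEventuallyZero I S.X₂ j) (h₁ : ExtEventuallyZero I S.X₁ (j + 1)) :
    ExtEventuallyZero I S.X₃ j := by
  intro n x
  obtain ⟨n', hn', hx⟩ := h₁ n (x.comp hS.extClass rfl)
  rw [extRestrict_comp] at hx
  obtain ⟨y, hy⟩ := Abelian.Ext.covariant_sequence_exact₃ _ hS _ _ hx
  obtain ⟨n'', hn'', hy'⟩ := h₂ n' y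
  refine ⟨n'', hn'.trans hn'', ?_⟩
  rw [← extRestrict_extRestrict hn' hn'', ← hy, extRestrict_comp, hy', Abelian.Ext.zero_comp]

theorem ExtEventuallyZero.fst {S : ShortComplex (ModuleCat.{u} R)} (hS : S.ShortExact) {j : ℕ}
    (h₃ : ExtEventuallyZero I S.X₃ j) (h₂ : ExtEventuallyZero I S.X₂ (j + 1)) :
    ExtEventuallyZero I S.X₁ (j + 1) := by
  intro n x
  obtain ⟨n', hn', hx⟩ := h₂ n (x.comp (Abelian.Ext.mk₀ S.f) (add_zero _))
  rw [extRestrict_comp] at hx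
  obtain ⟨y, hy⟩ := Abelian.Ext.covariant_sequence_exact₁ _ hS _ hx rfl
  obtain ⟨n'', hn'', hy'⟩ := h₃ n' y
  refine ⟨n'', hn'.trans hn'', ?_⟩
  rw [← extRestrict_extRestrict hn' hn'', ← hy, extRestrict_comp, hy', Abelian.Ext.zero_comp]

theorem ExtEventuallyZero.of_quotSMulTop {M : Type u} [AddCommGroup M] [Module R M] {x : R}
    (hxI : x ∈ I) (hx : IsSMulRegular M x) {j : ℕ}
    (h : ExtEventuallyZero I (ModuleCat.of R (QuotSMulTop x M)) j) :
    ExtEventuallyZero I (ModuleCat.of R M) (j + 1) := by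
  have hS : ((ModuleCat.of R M).smulShortComplex x).ShortExact :=
    IsSMulRegular.smulShortComplex_shortExact (M := ModuleCat.of R M) hx
  -- Powers of x are peeled off one at a time. If x^{t+1} y = 0, then x^t y comes from Ext^j into
  -- M/xM, so it dies after restriction, leaving a class killed by x^t. The process starts at t = n,
  -- as x^n kills R/I^n.
  have key : ∀ (t n : ℕ) (y : Abelian.Ext.{u} (quotPow I n) (ModuleCat.of R M) (j + 1)),
      x ^ t • y = 0 → ∃ (n' : ℕ) (hn : n ≤ n'), extRestrict hn y = 0 := by
    intro t
    induction t with
    | zero =>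
      intro n y hy
      exact ⟨n, le_rfl, by rw [← one_smul R y, ← pow_zero x, hy, map_zero]⟩
    | succ t ih =>
      intro n y hy
      obtain ⟨z, hz⟩ := (Abelian.Ext.exact_postcomp_δ_f hS (quotPow I n) j (x ^ t • y)).1
        ((mk₀_smulShortComplex_postcomp (M := ModuleCat.of R M) _).trans
          ((smul_smul x (x ^ t) y).trans ((congrArg (· • y) (pow_succ' x t).symm).trans hy)))
      obtain ⟨n', hn', hz'⟩ := h n z
      obtain ⟨n'', hn'', hy'⟩ := ih n' (extRestrict hn' y) (by
        rw [← map_smul, ← hz]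
        exact (extRestrict_comp hn' z hS.extClass rfl).trans
          ((congrArg (fun w => w.comp hS.extClass rfl) hz').trans
            (Abelian.Ext.zero_comp _ _ hS.extClass (j + 1) rfl)))
      exact ⟨n'', hn'.trans hn'', by rw [← extRestrict_extRestrict hn' hn'', hy']⟩
  intro n y
  refine key n n y (Abelian.Ext.smul_eq_zero_of_left (fun a => ?_) y)
  obtain ⟨a, rfl⟩ := Submodule.Quotient.mk_surjective _ a
  rw [← Submodule.Quotient.mk_smul, Submodule.Quotient.mk_eq_zero]
  exact Ideal.mul_mem_right a _ (Ideal.pow_mem_pow hxI n)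

end QuotientPowers

/-! ### Power torsion and essential extensions -/

section PowerTorsion

variable {R : Type u} [CommRing R] (I : Ideal R)

/-- The submodule of elements killed by a power of `I`. -/
def powTorsion (M : Type u) [AddCommGroup M] [Module R M] : Submodule R M where
  carrier := {x | ∃ n : ℕ, ∀ r ∈ I ^ n, r • x = 0}
  zero_mem' := ⟨0, fun r _ => smul_zero r⟩
  add_mem' := by
    rintro a b ⟨n, hn⟩ ⟨m, hm⟩
    refine ⟨max n m, fun r hr => ?_⟩
    rw [smul_add, hn r (Ideal.pow_le_pow_right (le_max_left n m) hr),
      hm r (Ideal.pow_le_pow_right (le_max_right n m) hr), add_zero]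
  smul_mem' := by
    rintro c x ⟨n, hn⟩
    exact ⟨n, fun r hr => by rw [smul_comm, hn r hr, smul_zero]⟩

variable {I}

theorem mem_powTorsion {M : Type u} [AddCommGroup M] [Module R M] {x : M} :
    x ∈ powTorsion I M ↔ ∃ n : ℕ, ∀ r ∈ I ^ n, r • x = 0 := Iff.rfl

/-- A finitely generated power torsion module is killed by a single power. -/
theorem exists_pow_smul_eq_zero_of_fg {M : Type u} [AddCommGroup M] [Module R M]
    {N : Submodule R M} (hN : N.FG) (h : N ≤ powTorsion I M) :
    ∃ n : ℕ, ∀ r ∈ I ^ n, ∀ x ∈ N, r • x = 0 := by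
  induction N, hN using Submodule.fg_induction with
  | singleton x =>
    obtain ⟨n, hn⟩ := h (Submodule.mem_span_singleton_self x)
    refine ⟨n, fun r hr y hy => ?_⟩
    obtain ⟨c, rfl⟩ := Submodule.mem_span_singleton.1 hy
    rw [smul_comm, hn r hr, smul_zero]
  | sup N₁ N₂ _ _ h₁ h₂ =>
    obtain ⟨n, hn⟩ := h₁ (le_sup_left.trans h)
    obtain ⟨m, hm⟩ := h₂ (le_sup_right.trans h)
    refine ⟨max n m, fun r hr y hy => ?_⟩
    obtain ⟨a, ha, b, hb, rfl⟩ := Submodule.mem_sup.1 hy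
    rw [smul_add, hn r (Ideal.pow_le_pow_right (le_max_left n m) hr) a ha,
      hm r (Ideal.pow_le_pow_right (le_max_right n m) hr) b hb, add_zero]

theorem powTorsion_eq_top_of_surjective {M N : Type u} [AddCommGroup M] [Module R M]
    [AddCommGroup N] [Module R N] (f : M →ₗ[R] N) (hf : Function.Surjective f)
    (h : powTorsion I M = ⊤) : powTorsion I N = ⊤ := by
  refine eq_top_iff.2 fun y _ => ?_
  obtain ⟨x, rfl⟩ := hf y
  obtain ⟨n, hn⟩ := mem_powTorsion.1 (h ▸ Submodule.mem_top : x ∈ powTorsion I M)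
  exact ⟨n, fun r hr => by rw [← map_smul, hn r hr, map_zero]⟩

theorem powTorsion_powTorsion {M : Type u} [AddCommGroup M] [Module R M] :
    powTorsion I (powTorsion I M) = ⊤ := by
  refine eq_top_iff.2 fun y _ => ?_
  obtain ⟨n, hn⟩ := y.2
  exact ⟨n, fun r hr => Subtype.ext (hn r hr)⟩

variable [IsNoetherianRing R]

/-- Essential extensions of power torsion modules are power torsion. -/
theorem powTorsion_eq_top_of_isEssential {M E : Type u} [AddCommGroup M] [Module R M]
    [AddCommGroup E] [Module R E] {f : M →ₗ[R] E} (hf : f.IsEssential)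
    (h : powTorsion I M = ⊤) : powTorsion I E = ⊤ := by
  refine eq_top_iff.2 fun y _ => ?_
  let Y : Submodule R E := Submodule.span R {y}
  have hYfg : Y.FG := Submodule.fg_span_singleton y
  have : IsNoetherian R Y := isNoetherian_of_fg_of_noetherian Y hYfg
  let N : Submodule R Y := (LinearMap.range f).comap Y.subtype
  have hN : N ≤ powTorsion I Y := by
    rintro z ⟨x, hx⟩
    obtain ⟨n, hn⟩ := mem_powTorsion.1 (h ▸ Submodule.mem_top : x ∈ powTorsion I M)
    refine ⟨n, fun r hr => Subtype.ext ?_⟩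
    change r • (z : E) = 0
    rw [show (z : E) = f x from hx.symm, ← map_smul, hn r hr, map_zero]
  obtain ⟨n, hn⟩ := exists_pow_smul_eq_zero_of_fg (IsNoetherian.noetherian N) hN
  -- Artin–Rees in Y = Ry: I^{k+n} Y ∩ N is contained in I^n N = 0. Essentiality then gives I^{k+n}
  -- y = 0.
  obtain ⟨k, hk⟩ := Ideal.exists_pow_inf_eq_pow_smul I N
  have hbot : I ^ (k + n) • (⊤ : Submodule R Y) ⊓ N = ⊥ := by
    rw [hk (k + n) (Nat.le_add_right k n), Nat.add_sub_cancel_left, eq_bot_iff,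
      Submodule.smul_le]
    intro r hr z hz
    exact (Submodule.mem_bot R).2 (hn r hr z hz.2)
  refine ⟨k + n, fun r hr => ?_⟩
  by_contra hne
  obtain ⟨c, hc0, hc⟩ := hf _ hne
  let z : Y := ⟨y, Submodule.mem_span_singleton_self y⟩
  have hz : c • r • z ∈ I ^ (k + n) • (⊤ : Submodule R Y) ⊓ N :=
    ⟨Submodule.smul_mem _ c (Submodule.smul_mem_smul hr trivial), hc⟩
  rw [hbot, Submodule.mem_bot] at hz
  exact hc0 (congrArg Subtype.val hz)

end PowerTorsion

/-! ### Local cohomology of torsion modules and torsion-free quotients -/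

section Vanishing

variable {R : Type u} [CommRing R]

/-- The short exact sequence `0 → M → E → E / M → 0` of an embedding. -/
theorem LinearMap.shortExact_mkQ_range {M E : Type u} [AddCommGroup M] [Module R M]
    [AddCommGroup E] [Module R E] {f : M →ₗ[R] E} (hf : Function.Injective f) :
    (ModuleCat.shortComplexOfCompEqZero f (LinearMap.range f).mkQ
      (LinearMap.range_mkQ_comp f)).ShortExact where
  exact := ModuleCat.shortComplex_exact _ (LinearMap.exact_map_mkQ_range f)
  mono_f := by rw [ModuleCat.mono_iff_injective]; exact hf
  epi_g := by rw [ModuleCat.epi_iff_surjective]; exact Submodule.mkQ_surjective _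

variable [IsNoetherianRing R] {I : Ideal R}

/-- An essential injective extension E of a torsion module is torsion, and so is E/M; this allows
dimension shifting down to degree one. -/
theorem ExtEventuallyZero.of_powTorsion_eq_top {M : Type u} [AddCommGroup M] [Module R M]
    (h : powTorsion I M = ⊤) (j : ℕ) : ExtEventuallyZero I (ModuleCat.of R M) (j + 1) := by
  induction j generalizing M with
  | zero =>
    obtain ⟨E, _, _, f, hE, hf, hess⟩ := Module.exists_essential_injective (R := R) M
    have hS := LinearMap.shortExact_mkQ_range hf
    intro n x
    obtain ⟨y, rfl⟩ := (Abelian.Ext.exact_postcomp_δ_f hS (quotPow I n) 0 x).1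
      ((subsingleton_ext_of_injective (quotPow I n) E 0).elim _ _)
    obtain ⟨φ, rfl⟩ := (Abelian.Ext.mk₀_bijective _ _).2 y
    -- A lift `c` of φ(1) to the torsion module E is killed by some I^m, so φ factors through E
    -- after restriction to R/I^{max n m}; the connecting map then kills it.
    obtain ⟨c, hc⟩ := Submodule.mkQ_surjective _ (φ.hom (Submodule.Quotient.mk 1))
    obtain ⟨m, hm⟩ := mem_powTorsion.1
      (powTorsion_eq_top_of_isEssential hess h ▸ Submodule.mem_top : c ∈ powTorsion I E)
    have hle : n ≤ max n m := le_max_left n m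
    let ψ : (R ⧸ I ^ max n m) →ₗ[R] E := Submodule.liftQ _ (LinearMap.toSpanSingleton R E c)
      fun r hr => hm r (Ideal.pow_le_pow_right (le_max_right n m) hr)
    have hψ : quotPowMap I hle ≫ φ =
        ModuleCat.ofHom ψ ≫ ModuleCat.ofHom (LinearMap.range f).mkQ := by
      refine ModuleCat.hom_ext (Submodule.linearMap_qext _ (LinearMap.ext_ring ?_))
      change φ.hom (Submodule.Quotient.mk 1) = (LinearMap.range f).mkQ ((1 : R) • c)
      rw [one_smul, hc]
    refine ⟨max n m, hle, ?_⟩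
    refine (extRestrict_comp hle (Abelian.Ext.mk₀ φ) hS.extClass rfl).trans ?_
    rw [extRestrict_mk₀, hψ, ← Abelian.Ext.mk₀_comp_mk₀]
    exact (Abelian.Ext.exact_postcomp_g_δ hS (quotPow I (max n m)) 0 _).2
      ⟨Abelian.Ext.mk₀ (ModuleCat.ofHom ψ), rfl⟩
  | succ j ih =>
    obtain ⟨E, _, _, f, hE, hf, hess⟩ := Module.exists_essential_injective (R := R) M
    refine ExtEventuallyZero.fst (LinearMap.shortExact_mkQ_range hf)
      (ih (powTorsion_eq_top_of_surjective (LinearMap.range f).mkQ (Submodule.mkQ_surjective _)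
        (powTorsion_eq_top_of_isEssential hess h))) ?_
    exact ExtEventuallyZero.of_subsingleton fun n => subsingleton_ext_of_injective _ E _

theorem ExtEventuallyZero.quotient_powTorsion {M : Type u} [AddCommGroup M] [Module R M]
    (h : ∀ j, ExtEventuallyZero I (ModuleCat.of R M) (j + 1)) (j : ℕ) :
    ExtEventuallyZero I (ModuleCat.of R (M ⧸ powTorsion I M)) j := by
  obtain _ | j := j
  · refine ExtEventuallyZero.of_subsingleton fun n => ?_
    refine (Abelian.Ext.linearMapEquiv (R ⧸ I ^ n) (M ⧸ powTorsion I M)).subsingleton_congr.2 ?_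
    refine subsingleton_of_forall_eq 0 fun φ => ?_
    refine Submodule.linearMap_qext _ (LinearMap.ext_ring ?_)
    change φ (Submodule.Quotient.mk 1) = 0
    obtain ⟨c, hc⟩ := Submodule.Quotient.mk_surjective _ (φ (Submodule.Quotient.mk 1))
    rw [← hc, Submodule.Quotient.mk_eq_zero]
    -- Here I^n c is finitely generated and torsion, so a single I^m kills it; then I^{m+n} c = 0
    -- and c is itself torsion.
    have hsub : Submodule.map (LinearMap.toSpanSingleton R M c) (I ^ n) ≤ powTorsion I M := by
      rintro _ ⟨r, hr, rfl⟩
      change r • c ∈ powTorsion I M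
      rw [← Submodule.Quotient.mk_eq_zero, Submodule.Quotient.mk_smul, hc, ← map_smul,
        ← Submodule.Quotient.mk_smul, smul_eq_mul, mul_one,
        (Submodule.Quotient.mk_eq_zero (I ^ n)).2 hr, map_zero]
    obtain ⟨m, hm⟩ := exists_pow_smul_eq_zero_of_fg
      (Submodule.FG.map _ ((isNoetherianRing_iff_ideal_fg R).1 ‹_› (I ^ n))) hsub
    refine ⟨m + n, fun r hr => ?_⟩
    rw [pow_add] at hr
    refine Submodule.mul_induction_on hr (fun a ha b hb => ?_) fun a b h1 h2 => ?_
    · rw [mul_smul]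
      exact hm a ha _ ⟨b, hb, rfl⟩
    · rw [add_smul, h1, h2, add_zero]
  · exact ExtEventuallyZero.trd (powTorsion I M).shortExact_mkQ (h j)
      (ExtEventuallyZero.of_powTorsion_eq_top powTorsion_powTorsion (j + 1))

end Vanishing

/-! ### Socles and vanishing over a local ring -/

section Vanishing

variable {R : Type u} [CommRing R] [IsLocalRing R]

theorem subsingleton_ext_residueField_zero_iff (Q : Type u) [AddCommGroup Q] [Module R Q] :
    Subsingleton (Abelian.Ext.{u} (residueFieldObj R) (ModuleCat.of R Q) 0) ↔
      ∀ q : Q, (∀ r ∈ maximalIdeal R, r • q = 0) → q = 0 := by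
  rw [(Abelian.Ext.linearMapEquiv (ResidueField R) Q).subsingleton_congr]
  constructor
  · intro h q hq
    let f : (R ⧸ maximalIdeal R) →ₗ[R] Q :=
      Submodule.liftQ _ (LinearMap.toSpanSingleton R Q q) hq
    have h1 : f (Submodule.Quotient.mk 1) = (1 : R) • q := rfl
    have h2 : f = 0 := h.elim f 0
    rw [← one_smul R q, ← h1, h2, LinearMap.zero_apply]
  · refine fun h => subsingleton_of_forall_eq 0 fun f => ?_
    refine LinearMap.ext fun x => h _ fun r hr => ?_
    rw [← map_smul, smul_residueField_eq_zero R hr, map_zero]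

/-- A nonzero socle element of E has a nonzero multiple in Q, again a socle element. -/
theorem LinearMap.IsEssential.subsingleton_ext_zero {Q E : Type u} [AddCommGroup Q] [Module R Q]
    [AddCommGroup E] [Module R E] {f : Q →ₗ[R] E} (hess : f.IsEssential)
    (hf : Function.Injective f)
    (h : Subsingleton (Abelian.Ext.{u} (residueFieldObj R) (ModuleCat.of R Q) 0)) :
    Subsingleton (Abelian.Ext.{u} (residueFieldObj R) (ModuleCat.of R E) 0) := by
  rw [subsingleton_ext_residueField_zero_iff] at h ⊢
  intro e he
  by_contra hne
  obtain ⟨r, hr0, q, hq⟩ := hess e hne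
  refine hr0 ?_
  rw [← hq, h q fun a ha => hf ?_, map_zero]
  rw [map_smul, hq, smul_comm, he a ha, smul_zero, map_zero]

variable [IsNoetherianRing R]

theorem isFiniteLength_of_pow_smul_eq_zero (n : ℕ) (M : Type u) [AddCommGroup M] [Module R M]
    [Module.Finite R M] (h : ∀ r ∈ maximalIdeal R ^ n, ∀ x : M, r • x = 0) :
    IsFiniteLength R M := by
  induction n generalizing M with
  | zero =>
    have : Subsingleton M := subsingleton_of_forall_eq 0 fun x => by
      simpa using h 1 (by simp) x
    exact .of_subsingleton
  | succ n ih =>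
    let N : Submodule R M := maximalIdeal R • ⊤
    have hN : IsFiniteLength R N := by
      refine ih N fun r hr x => Subtype.ext ?_
      change r • (x : M) = 0
      refine Submodule.smul_induction_on (p := fun y => r • y = 0) x.2 (fun a ha y _ => ?_)
        fun a b ha hb => by rw [smul_add, ha, hb, add_zero]
      rw [smul_smul]
      exact h _ (by rw [pow_succ]; exact Ideal.mul_mem_mul hr ha) y
    have hQ : IsFiniteLength R (M ⧸ N) := by
      refine isFiniteLength_of_smul_eq_zero (J := maximalIdeal R) isFiniteLength_residueField _
        fun r hr x => ?_
      obtain ⟨x, rfl⟩ := Submodule.Quotient.mk_surjective _ x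
      rw [← Submodule.Quotient.mk_smul, Submodule.Quotient.mk_eq_zero]
      exact Submodule.smul_mem_smul hr trivial
    rw [← Module.length_ne_top_iff] at hN hQ ⊢
    rw [Module.length_eq_add_of_exact N.subtype N.mkQ N.injective_subtype N.mkQ_surjective
      (LinearMap.exact_subtype_mkQ N)]
    exact WithTop.add_ne_top.2 ⟨hN, hQ⟩

theorem isFiniteLength_quotPow (n : ℕ) : IsFiniteLength R (R ⧸ maximalIdeal R ^ n) :=
  isFiniteLength_of_pow_smul_eq_zero n _ fun r hr x => by
    obtain ⟨x, rfl⟩ := Submodule.Quotient.mk_surjective _ x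
    rw [← Submodule.Quotient.mk_smul, Submodule.Quotient.mk_eq_zero]
    exact Ideal.mul_mem_right x _ hr

theorem subsingleton_ext_quotPow {V : ModuleCat.{u} R} {i : ℕ}
    (hV : Subsingleton (Abelian.Ext.{u} (residueFieldObj R) V i)) (n : ℕ) :
    Subsingleton (Abelian.Ext.{u} (quotPow (maximalIdeal R) n) V i) :=
  subsingleton_ext_of_isFiniteLength hV (isFiniteLength_quotPow n)

theorem subsingleton_ext_quotPow_of_injective {E : Type u} [AddCommGroup E] [Module R E]
    [Module.Injective R E]
    (h : Subsingleton (Abelian.Ext.{u} (residueFieldObj R) (ModuleCat.of R E) 0)) (n j : ℕ) :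
    Subsingleton (Abelian.Ext.{u} (quotPow (maximalIdeal R) n) (ModuleCat.of R E) j) := by
  obtain _ | j := j
  · exact subsingleton_ext_quotPow h n
  · exact subsingleton_ext_of_injective _ E j

/-- A module without local cohomology has no Bass numbers. -/
theorem subsingleton_ext_of_extEventuallyZero {Q : Type u} [AddCommGroup Q] [Module R Q]
    (h : ∀ j, ExtEventuallyZero (maximalIdeal R) (ModuleCat.of R Q) j) (i : ℕ) :
    Subsingleton (Abelian.Ext.{u} (residueFieldObj R) (ModuleCat.of R Q) i) := by
  have h0 : ∀ {Q : Type u} [AddCommGroup Q] [Module R Q],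
      ExtEventuallyZero (maximalIdeal R) (ModuleCat.of R Q) 0 →
      Subsingleton (Abelian.Ext.{u} (residueFieldObj R) (ModuleCat.of R Q) 0) := by
    intro Q _ _ h
    rw [subsingleton_ext_residueField_zero_iff]
    intro q hq
    -- A socle element is a map from R/𝔪^1. Restriction along R/𝔪^n → R/𝔪 still sends 1 to `q`, so
    -- it can vanish only if q = 0.
    let f : (R ⧸ maximalIdeal R ^ 1) →ₗ[R] Q :=
      Submodule.liftQ _ (LinearMap.toSpanSingleton R Q q) (by rwa [pow_one])
    obtain ⟨n, hn, hz⟩ := h 1 (Abelian.Ext.mk₀ (ModuleCat.ofHom f))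
    rw [extRestrict_mk₀, Abelian.Ext.mk₀_eq_zero_iff] at hz
    have h1 := congrArg (fun g => ModuleCat.Hom.hom g (Submodule.Quotient.mk 1)) hz
    change (1 : R) • q = 0 at h1
    rwa [one_smul] at h1
  induction i generalizing Q with
  | zero => exact h0 (h 0)
  | succ i ih =>
    -- The hull E has no socle, so all Ext(R/𝔪^n, E) vanish and E/Q inherits the hypothesis, shifted
    -- by one degree.
    obtain ⟨E, _, _, f, hE, hf, hess⟩ := Module.exists_essential_injective (R := R) Q
    have hE0 := hess.subsingleton_ext_zero hf (h0 (h 0))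
    have hS := LinearMap.shortExact_mkQ_range hf
    refine Abelian.Ext.subsingleton_fst hS (ih fun j => ?_) (subsingleton_ext_of_injective _ E i)
    exact ExtEventuallyZero.trd hS
      (.of_subsingleton fun n => subsingleton_ext_quotPow_of_injective hE0 n j) (h (j + 1))

/-- Grothendieck vanishing for a Cohen-Macaulay module. -/
theorem ExtEventuallyZero.of_supportDim_le {s : ℕ} (M : Type u) [AddCommGroup M] [Module R M]
    [Module.Finite R M]
    (hM : ∀ j < s, Subsingleton (Abelian.Ext.{u} (residueFieldObj R) (ModuleCat.of R M) j))
    (hdim : Module.supportDim R M ≤ s) (j : ℕ) (hj : s < j) :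
    ExtEventuallyZero (maximalIdeal R) (ModuleCat.of R M) j := by
  induction s generalizing M j with
  | zero =>
    obtain ⟨j, rfl⟩ := Nat.exists_eq_succ_of_ne_zero hj.ne'
    refine ExtEventuallyZero.of_powTorsion_eq_top ?_ j
    have hf := isFiniteLength_iff_isNoetherian_isArtinian.1
      (isFiniteLength_of_supportDim_le_zero M hdim)
    have := hf.2
    -- The descending chain 𝔪^n M stabilizes, and Nakayama makes its stable value zero.
    obtain ⟨n, hn⟩ := IsArtinian.monotone_stabilizes
      (⟨fun n => OrderDual.toDual (maximalIdeal R ^ n • (⊤ : Submodule R M)),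
        fun a b hab => Submodule.smul_mono_left (Ideal.pow_le_pow_right hab)⟩ :
        ℕ →o (Submodule R M)ᵒᵈ)
    have h1 : maximalIdeal R • (maximalIdeal R ^ n • (⊤ : Submodule R M)) =
        maximalIdeal R ^ n • (⊤ : Submodule R M) := by
      rw [← Submodule.mul_smul, ← pow_succ']
      exact (hn (n + 1) (Nat.le_succ n)).symm
    have h2 : maximalIdeal R ^ n • (⊤ : Submodule R M) = ⊥ :=
      Submodule.eq_bot_of_le_smul_of_le_jacobson_bot (maximalIdeal R) _
        (IsNoetherian.noetherian _) h1.ge (maximalIdeal_le_jacobson _)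
    refine eq_top_iff.2 fun x _ => ⟨n, fun r hr => ?_⟩
    rw [← Submodule.mem_bot R, ← h2]
    exact Submodule.smul_mem_smul hr trivial
  | succ s ih =>
    obtain ⟨j, rfl⟩ := Nat.exists_eq_succ_of_ne_zero (Nat.ne_zero_of_lt hj)
    obtain ⟨x, hxm, hx, -⟩ := exists_isSMulRegular_pair M M
      (hM 0 (Nat.succ_pos s)) (hM 0 (Nat.succ_pos s))
    refine ExtEventuallyZero.of_quotSMulTop hxm hx (ih (QuotSMulTop x M) (fun j hj => ?_)
      (supportDim_quotSMulTop_le hx hxm hdim) j (Nat.lt_of_succ_lt_succ hj))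
    exact subsingleton_ext_quotSMulTop hx (hM j (hj.trans (Nat.lt_succ_self s)))
        (hM (j + 1) (Nat.succ_lt_succ hj))

end Vanishing

/-! ### Local cohomology as a colimit, and its Bass numbers -/

section ExtColimit

variable {R : Type u} [CommRing R]

/-- The module `L` is the colimit of the modules `Ext^j(R / I ^ n, M)`. -/
structure ExtColimit (I : Ideal R) (M : ModuleCat.{u} R) (j : ℕ) (L : Type u) [AddCommGroup L]
    [Module R L] where
  /-- The structure maps. -/
  ι (n : ℕ) : Abelian.Ext.{u} (quotPow I n) M j →ₗ[R] L
  ι_restrict {n n' : ℕ} (h : n ≤ n') (x : Abelian.Ext.{u} (quotPow I n) M j) :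
    ι n' (extRestrict h x) = ι n x
  exists_ι_eq (y : L) : ∃ n x, ι n x = y
  exists_restrict_eq_zero (n : ℕ) (x : Abelian.Ext.{u} (quotPow I n) M j) (hx : ι n x = 0) :
    ∃ (n' : ℕ) (h : n ≤ n'), extRestrict h x = 0

namespace ExtColimit

variable {I : Ideal R} {M : ModuleCat.{u} R} {j : ℕ} {L L' : Type u} [AddCommGroup L] [Module R L]
  [AddCommGroup L'] [Module R L']

/-- The graph of the comparison between two colimits. -/
def graph (c : ExtColimit I M j L) (c' : ExtColimit I M j L') : Submodule R (L × L') where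
  carrier := {p | ∃ n x, (c.ι n x, c'.ι n x) = p}
  zero_mem' := ⟨0, 0, by rw [map_zero, map_zero]; rfl⟩
  add_mem' := by
    rintro _ _ ⟨n, x, rfl⟩ ⟨m, y, rfl⟩
    refine ⟨max n m, extRestrict (le_max_left n m) x + extRestrict (le_max_right n m) y, ?_⟩
    rw [map_add, map_add, c.ι_restrict, c.ι_restrict, c'.ι_restrict, c'.ι_restrict]
    rfl
  smul_mem' := by
    rintro r _ ⟨n, x, rfl⟩
    exact ⟨n, r • x, by rw [map_smul, map_smul]; rfl⟩

theorem bijective_fst (c : ExtColimit I M j L) (c' : ExtColimit I M j L') :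
    Function.Bijective (LinearMap.fst R L L' ∘ₗ (c.graph c').subtype) := by
  refine ⟨(injective_iff_map_eq_zero _).2 ?_, fun y => ?_⟩
  · rintro ⟨_, n, x, rfl⟩ (hx : c.ι n x = 0)
    obtain ⟨n', h, hx'⟩ := c.exists_restrict_eq_zero n x hx
    refine Subtype.ext (Prod.ext hx ?_)
    change c'.ι n x = 0
    rw [← c'.ι_restrict h, hx', map_zero]
  · obtain ⟨n, x, rfl⟩ := c.exists_ι_eq y
    exact ⟨⟨_, n, x, rfl⟩, rfl⟩

theorem bijective_snd (c : ExtColimit I M j L) (c' : ExtColimit I M j L') :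
    Function.Bijective (LinearMap.snd R L L' ∘ₗ (c.graph c').subtype) := by
  refine ⟨(injective_iff_map_eq_zero _).2 ?_, fun y => ?_⟩
  · rintro ⟨_, n, x, rfl⟩ (hx : c'.ι n x = 0)
    obtain ⟨n', h, hx'⟩ := c'.exists_restrict_eq_zero n x hx
    refine Subtype.ext (Prod.ext ?_ hx)
    change c.ι n x = 0
    rw [← c.ι_restrict h, hx', map_zero]
  · obtain ⟨n, x, rfl⟩ := c'.exists_ι_eq y
    exact ⟨⟨_, n, x, rfl⟩, rfl⟩

/-- Colimits are unique. -/
def uniqueUpToIso (c : ExtColimit I M j L) (c' : ExtColimit I M j L') : L ≃ₗ[R] L' :=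
  (LinearEquiv.ofBijective _ (c.bijective_fst c')).symm.trans
    (LinearEquiv.ofBijective _ (c.bijective_snd c'))

theorem subsingleton (c : ExtColimit I M j L)
    (h : ∀ n, Subsingleton (Abelian.Ext.{u} (quotPow I n) M j)) : Subsingleton L :=
  subsingleton_of_forall_eq 0 fun y => by
    obtain ⟨n, x, rfl⟩ := c.exists_ι_eq y
    rw [(h n).elim x 0, map_zero]

/-- Dimension shifting. -/
def shift {S : ShortComplex (ModuleCat.{u} R)} (hS : S.ShortExact)
    (c : ExtColimit I S.X₁ (j + 1) L)
    (h₀ : ∀ n, Subsingleton (Abelian.Ext.{u} (quotPow I n) S.X₂ j))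
    (h₁ : ∀ n, Subsingleton (Abelian.Ext.{u} (quotPow I n) S.X₂ (j + 1))) :
    ExtColimit I S.X₃ j L where
  ι n := c.ι n ∘ₗ (Abelian.Ext.shiftEquiv hS (quotPow I n) j (h₀ n) (h₁ n)).toLinearMap
  ι_restrict {n n'} h x := by
    refine (congrArg (c.ι n') ?_).trans
      (c.ι_restrict h (Abelian.Ext.shiftEquiv hS (quotPow I n) j (h₀ n) (h₁ n) x))
    exact (extRestrict_comp h x hS.extClass rfl).symm
  exists_ι_eq y := by
    obtain ⟨n, x, rfl⟩ := c.exists_ι_eq y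
    exact ⟨n, (Abelian.Ext.shiftEquiv hS (quotPow I n) j (h₀ n) (h₁ n)).symm x,
      congrArg (c.ι n) (LinearEquiv.apply_symm_apply _ x)⟩
  exists_restrict_eq_zero n x hx := by
    obtain ⟨n', h, hx'⟩ := c.exists_restrict_eq_zero n _ hx
    refine ⟨n', h, (Abelian.Ext.shiftEquiv hS (quotPow I n') j (h₀ n') (h₁ n')).injective ?_⟩
    rw [map_zero]
    exact (extRestrict_comp h x hS.extClass rfl).symm.trans hx'

variable (I) in
/-- In degree zero the colimit is the power torsion. -/
def ofPowTorsion (C : Type u) [AddCommGroup C] [Module R C] :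
    ExtColimit I (ModuleCat.of R C) 0 (powTorsion I C) where
  ι n := ((LinearMap.applyₗ (Submodule.Quotient.mk 1)) ∘ₗ
      (Abelian.Ext.linearMapEquiv (R ⧸ I ^ n) C).toLinearMap).codRestrict (powTorsion I C)
    fun x => ⟨n, fun r hr => by
      change r • Abelian.Ext.linearMapEquiv (R ⧸ I ^ n) C x (Submodule.Quotient.mk 1) = 0
      rw [← map_smul, ← Submodule.Quotient.mk_smul, smul_eq_mul, mul_one,
        (Submodule.Quotient.mk_eq_zero (I ^ n)).2 hr, map_zero]⟩
  ι_restrict {n n'} h x := by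
    obtain ⟨⟨f⟩, rfl⟩ := (Abelian.Ext.mk₀_bijective _ _).2 x
    refine Subtype.ext ?_
    change Abelian.Ext.linearMapEquiv _ _ _ _ = Abelian.Ext.linearMapEquiv _ _ _ _
    rw [extRestrict_mk₀]
    exact (congrFun (congrArg DFunLike.coe (Abelian.Ext.linearMapEquiv_mk₀ _)) _).trans
      (congrFun (congrArg DFunLike.coe (Abelian.Ext.linearMapEquiv_mk₀ f)) _).symm
  exists_ι_eq := by
    rintro ⟨c, n, hn⟩
    let f : (R ⧸ I ^ n) →ₗ[R] C := Submodule.liftQ _ (LinearMap.toSpanSingleton R C c) hn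
    refine ⟨n, Abelian.Ext.mk₀ (ModuleCat.ofHom f), Subtype.ext ?_⟩
    refine (congrFun (congrArg DFunLike.coe (Abelian.Ext.linearMapEquiv_mk₀ f)) _).trans ?_
    exact one_smul R c
  exists_restrict_eq_zero n x hx := by
    refine ⟨n, le_rfl, ?_⟩
    have hx0 : x = 0 := by
      refine (Abelian.Ext.linearMapEquiv (R ⧸ I ^ n) C).injective ?_
      rw [map_zero]
      refine Submodule.linearMap_qext _ (LinearMap.ext_ring ?_)
      exact congrArg Subtype.val hx
    rw [hx0, map_zero]

end ExtColimit

/-- The Bass numbers of a module whose only nonvanishing local cohomology is in degree `d`. -/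
theorem length_ext_eq_of_extColimit [IsLocalRing R] [IsNoetherianRing R] {d : ℕ} {M L : Type u}
    [AddCommGroup M] [Module R M] [AddCommGroup L] [Module R L]
    (c : ExtColimit (maximalIdeal R) (ModuleCat.of R M) d L)
    (hlt : ∀ j < d, Subsingleton (Abelian.Ext.{u} (residueFieldObj R) (ModuleCat.of R M) j))
    (hgt : ∀ j, d < j → ExtEventuallyZero (maximalIdeal R) (ModuleCat.of R M) j) (i : ℕ) :
    Module.length R (Abelian.Ext.{u} (residueFieldObj R) (ModuleCat.of R L) i) =
      Module.length R (Abelian.Ext.{u} (residueFieldObj R) (ModuleCat.of R M) (d + i)) := by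
  induction d generalizing M i with
  | zero =>
    -- M/Γ has no local cohomology, hence no Ext from k, so Γ → M induces isomorphisms on Ext(k, -).
    have hQ := subsingleton_ext_of_extEventuallyZero
      (ExtEventuallyZero.quotient_powTorsion fun j => hgt (j + 1) (Nat.succ_pos j))
    have hS := (powTorsion (maximalIdeal R) M).shortExact_mkQ
    have hinj : Function.Injective ((Abelian.Ext.mk₀
        (powTorsion (maximalIdeal R) M).shortComplexMkQ.f).postcompOfLinear R
          (residueFieldObj R) (add_zero i)) := by
      obtain _ | i := i
      · exact Abelian.Ext.injective_postcomp_f hS _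
      · refine (injective_iff_map_eq_zero _).2 fun x hx => ?_
        obtain ⟨y, rfl⟩ := (Abelian.Ext.exact_postcomp_δ_f hS _ i x).1 hx
        rw [(hQ i).elim y 0, map_zero]
    have hsurj : Function.Surjective ((Abelian.Ext.mk₀
        (powTorsion (maximalIdeal R) M).shortComplexMkQ.f).postcompOfLinear R
          (residueFieldObj R) (add_zero i)) := fun x =>
      (Abelian.Ext.exact_postcomp_f_g hS _ i x).1 ((hQ i).elim _ _)
    rw [zero_add, ← (LinearEquiv.ofBijective _ ⟨hinj, hsurj⟩).length_eq]
    exact (Abelian.Ext.congrRight _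
      (c.uniqueUpToIso (ExtColimit.ofPowTorsion _ M)).toModuleIso i).length_eq
  | succ d ih =>
    obtain ⟨E, _, _, f, hE, hf, hess⟩ := Module.exists_essential_injective (R := R) M
    -- Positive depth leaves E without socle: Ext(k, E) and Ext(R/𝔪^n, E) vanish in every degree,
    -- and passing to E/M shifts both sides by one.
    have hE0 := hess.subsingleton_ext_zero hf (hlt 0 (Nat.succ_pos d))
    have hEk : ∀ j, Subsingleton
        (Abelian.Ext.{u} (residueFieldObj R) (ModuleCat.of R E) j) := by
      rintro (_ | j)
      · exact hE0
      · exact subsingleton_ext_of_injective _ E j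
    have hEn := fun n j => subsingleton_ext_quotPow_of_injective hE0 n j
    have hS := LinearMap.shortExact_mkQ_range hf
    rw [Nat.succ_add]
    refine (ih (M := E ⧸ LinearMap.range f)
      (c.shift hS (fun n => hEn n d) (fun n => hEn n (d + 1))) (fun j hj => ?_)
      (fun j hj => ?_) i).trans ?_
    · exact Abelian.Ext.subsingleton_trd hS (hEk j) (hlt (j + 1) (Nat.succ_lt_succ hj))
    · exact ExtEventuallyZero.trd hS (.of_subsingleton fun n => hEn n j)
        (hgt (j + 1) (Nat.succ_lt_succ hj))
    · exact (Abelian.Ext.shiftEquiv hS (residueFieldObj R) (d + i) (hEk _) (hEk _)).length_eq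

end ExtColimit

/-- Two quotients of a module with the same kernel are isomorphic. -/
def LinearMap.equivOfKerEq {R A B C : Type*} [Ring R] [AddCommGroup A] [AddCommGroup B]
    [AddCommGroup C] [Module R A] [Module R B] [Module R C] (f : A →ₗ[R] B) (g : A →ₗ[R] C)
    (hf : Function.Surjective f) (hg : Function.Surjective g) (h : LinearMap.ker f = LinearMap.ker g) :
    B ≃ₗ[R] C :=
  (f.quotKerEquivOfSurjective hf).symm.trans
    ((Submodule.quotEquivOfEq _ _ h).trans (g.quotKerEquivOfSurjective hg))

theorem LinearMap.equivOfKerEq_apply {R A B C : Type*} [Ring R] [AddCommGroup A] [AddCommGroup B]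
    [AddCommGroup C] [Module R A] [Module R B] [Module R C] (f : A →ₗ[R] B) (g : A →ₗ[R] C)
    (hf : Function.Surjective f) (hg : Function.Surjective g) (h : LinearMap.ker f = LinearMap.ker g)
    (a : A) : f.equivOfKerEq g hf hg h (f a) = g a := by
  have h1 : (f.quotKerEquivOfSurjective hf).symm (f a) = Submodule.Quotient.mk a :=
    (LinearEquiv.symm_apply_eq _).2 rfl
  rw [LinearMap.equivOfKerEq, LinearEquiv.trans_apply, h1]
  rfl

/-! ### Cycles and homology on elements -/

namespace HomologicalComplex

variable {R : Type u} [CommRing R] {ι : Type*} {c : ComplexShape ι}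
  (K : HomologicalComplex (ModuleCat.{u} R) c)

theorem iCycles_injective (i : ι) : Function.Injective (K.iCycles i) :=
  (ModuleCat.mono_iff_injective _).1 inferInstance

theorem homologyπ_surjective (i : ι) : Function.Surjective (K.homologyπ i) :=
  (ModuleCat.epi_iff_surjective _).1 inferInstance

theorem d_iCycles_apply (i j : ι) (z : K.cycles i) : K.d i j (K.iCycles i z) = 0 :=
  congrArg (fun f : K.cycles i ⟶ K.X j => f z) (K.iCycles_d i j)

theorem exists_iCycles_eq {i j : ι} (hj : c.next i = j) (x : K.X i) (hx : K.d i j x = 0) :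
    ∃ z : K.cycles i, K.iCycles i z = x :=
  (ShortComplex.moduleCat_exact_iff _).1
    (ShortComplex.exact_of_f_is_kernel (ShortComplex.mk _ _ (K.iCycles_d i j))
      (K.cyclesIsKernel i j hj)) x hx

theorem homologyπ_eq_zero_iff {i j : ι} (hi : c.prev j = i) (z : K.cycles j) :
    K.homologyπ j z = 0 ↔ ∃ w : K.X i, K.d i j w = K.iCycles j z := by
  constructor
  · intro h
    obtain ⟨w, rfl⟩ := (ShortComplex.moduleCat_exact_iff _).1
      (ShortComplex.exact_of_g_is_cokernel (ShortComplex.mk _ _ (K.toCycles_comp_homologyπ i j))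
        (K.homologyIsCokernel i j hi)) z h
    exact ⟨w, (congrArg (fun f : K.X i ⟶ K.X j => f w) (K.toCycles_i i j)).symm⟩
  · rintro ⟨w, hw⟩
    have h1 : K.toCycles i j w = z := K.iCycles_injective j
      ((congrArg (fun f : K.X i ⟶ K.X j => f w) (K.toCycles_i i j)).trans hw)
    rw [← h1]
    exact congrArg (fun f : K.X i ⟶ K.homology j => f w) (K.toCycles_comp_homologyπ i j)

end HomologicalComplex

/-! ### Comparing the derived functor `Ext` with `Abelian.Ext` -/

namespace CategoryTheory.ProjectiveResolution

variable {R : Type u} [CommRing R] {X Y : ModuleCat.{u} R} (P : ProjectiveResolution X)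

/-- Using `prev` treats all degrees uniformly. In degree zero `prev 0 = 0` and the differential is
zero, so the criterion reads f = 0. -/
theorem extMk_eq_zero_iff_next {n : ℕ} (f : P.complex.X n ⟶ Y)
    (hf : P.complex.d (n + 1) n ≫ f = 0) :
    P.extMk f (n + 1) rfl hf = 0 ↔ ∃ g : P.complex.X ((ComplexShape.up ℕ).prev n) ⟶ Y,
      P.complex.d n ((ComplexShape.up ℕ).prev n) ≫ g = f := by
  obtain _ | n := n
  · rw [P.complex.shape 0 _ (by simp)]
    simp only [← P.extEquivCohomologyClass.apply_eq_iff_eq, extEquivCohomologyClass_extMk,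
      extEquivCohomologyClass_zero, CochainComplex.HomComplex.CohomologyClass.mk_eq_zero_iff]
    rw [CochainComplex.HomComplex.Cocycle.toSingleMk_mem_coboundaries_iff _ _ _ _ _ 1 (by lia)]
    have hz : Limits.IsZero (P.cochainComplex.X 1) := P.cochainComplex.isZero_of_isStrictlyLE 0 1
    constructor
    · rintro ⟨g, hg⟩
      refine ⟨0, ?_⟩
      rw [hz.eq_of_src g 0, Limits.comp_zero, eq_comm] at hg
      rw [← cancel_epi (P.cochainComplexXIso (-(0 : ℕ)) 0 rfl).hom, hg]
      simp
    · rintro ⟨g, hg⟩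
      refine ⟨0, ?_⟩
      rw [← hg]
      simp
  · rw [P.extMk_eq_zero_iff f (n + 1 + 1) rfl hf n rfl, CochainComplex.prev_nat_succ]

/-- The morphism underlying a cocycle. -/
def homOfCocycle {n : ℕ} (z : (P.complex.linearYonedaObj R Y).cycles n) : P.complex.X n ⟶ Y :=
  (P.complex.linearYonedaObj R Y).iCycles n z

theorem d_homOfCocycle {n : ℕ} (z : (P.complex.linearYonedaObj R Y).cycles n) :
    P.complex.d (n + 1) n ≫ P.homOfCocycle z = 0 :=
  (P.complex.linearYonedaObj R Y).d_iCycles_apply n (n + 1) z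

theorem exists_homOfCocycle_eq {n : ℕ} (f : P.complex.X n ⟶ Y)
    (hf : P.complex.d (n + 1) n ≫ f = 0) :
    ∃ z : (P.complex.linearYonedaObj R Y).cycles n, P.homOfCocycle z = f :=
  (P.complex.linearYonedaObj R Y).exists_iCycles_eq (i := n) (j := n + 1) (by simp) f hf

theorem extMk_congr {n : ℕ} {f f' : P.complex.X n ⟶ Y} (h : f = f')
    (hf : P.complex.d (n + 1) n ≫ f = 0) :
    P.extMk f (n + 1) rfl hf = P.extMk f' (n + 1) rfl (h ▸ hf) := by
  subst h
  rfl

variable (Y) in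
/-- The class of a cocycle, as a linear map. -/
def extOfCocycle (n : ℕ) :
    (P.complex.linearYonedaObj R Y).cycles n →ₗ[R] Abelian.Ext.{u} X Y n where
  toFun z := P.extMk (P.homOfCocycle z) (n + 1) rfl (P.d_homOfCocycle z)
  map_add' a b := by
    rw [add_extMk]
    exact P.extMk_congr (map_add _ a b) _
  map_smul' r a := by
    rw [RingHom.id_apply, ← Abelian.Ext.comp_mk₀_id (P.extMk (P.homOfCocycle a) _ _ _),
      ← Abelian.Ext.comp_smul, ← Abelian.Ext.mk₀_smul, extMk_comp_mk₀]
    refine P.extMk_congr ?_ _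
    rw [Linear.comp_smul, Category.comp_id]
    exact map_smul _ r a

theorem extOfCocycle_apply (n : ℕ) (z : (P.complex.linearYonedaObj R Y).cycles n) :
    P.extOfCocycle Y n z = P.extMk (P.homOfCocycle z) (n + 1) rfl (P.d_homOfCocycle z) := rfl

theorem extOfCocycle_surjective (n : ℕ) : Function.Surjective (P.extOfCocycle Y n) := by
  intro x
  obtain ⟨f, hf, rfl⟩ := P.extMk_surjective x (n + 1) rfl
  obtain ⟨z, rfl⟩ := P.exists_homOfCocycle_eq f hf
  exact ⟨z, rfl⟩

theorem extOfCocycle_eq_zero_iff (n : ℕ) (z : (P.complex.linearYonedaObj R Y).cycles n) :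
    P.extOfCocycle Y n z = 0 ↔ (P.complex.linearYonedaObj R Y).homologyπ n z = 0 := by
  rw [HomologicalComplex.homologyπ_eq_zero_iff _ rfl]
  exact P.extMk_eq_zero_iff_next _ (P.d_homOfCocycle z)

variable (Y) in
/-- The class of a cocycle in the derived functor `Ext`, as a linear map. -/
def extFunctorOfCocycle (n : ℕ) : (P.complex.linearYonedaObj R Y).cycles n →ₗ[R]
    ((Ext R (ModuleCat.{u} R) n).obj (Opposite.op X)).obj Y :=
  ((P.complex.linearYonedaObj R Y).homologyπ n ≫ (P.isoExt n Y).inv).hom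

/-- Comparison of the derived functor `Ext` and the groups of extensions. -/
def extFunctorEquiv (n : ℕ) : ((Ext R (ModuleCat.{u} R) n).obj (Opposite.op X)).obj Y ≃ₗ[R]
    Abelian.Ext.{u} X Y n :=
  LinearMap.equivOfKerEq (P.extFunctorOfCocycle Y n) (P.extOfCocycle Y n)
    ((P.isoExt n Y).symm.toLinearEquiv.surjective.comp
      (HomologicalComplex.homologyπ_surjective _ n))
    (P.extOfCocycle_surjective n) <| by
      ext z
      rw [LinearMap.mem_ker, LinearMap.mem_ker, extOfCocycle_eq_zero_iff]
      exact (P.isoExt n Y).symm.toLinearEquiv.map_eq_zero_iff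

theorem extFunctorEquiv_apply (n : ℕ) (z : (P.complex.linearYonedaObj R Y).cycles n) :
    P.extFunctorEquiv n (P.extFunctorOfCocycle Y n z) = P.extOfCocycle Y n z :=
  LinearMap.equivOfKerEq_apply ..

variable {X' : ModuleCat.{u} R} {P' : ProjectiveResolution X'} {g : X' ⟶ X} {P}

variable (Y) in
/-- The map of cochain complexes induced by a map of resolutions. -/
def linearYonedaMap (φ : Hom P' P g) :
    P.complex.linearYonedaObj R Y ⟶ P'.complex.linearYonedaObj R Y :=
  (HomologicalComplex.unopFunctor _ _).map
    (((((linearYoneda R (ModuleCat.{u} R)).obj Y).rightOp.mapHomologicalComplex _).map φ.hom).op)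

theorem homOfCocycle_cyclesMap (φ : Hom P' P g) (n : ℕ)
    (z : (P.complex.linearYonedaObj R Y).cycles n) :
    P'.homOfCocycle (HomologicalComplex.cyclesMap (linearYonedaMap Y φ) n z) =
      φ.hom.f n ≫ P.homOfCocycle z :=
  congrArg (fun f : (P.complex.linearYonedaObj R Y).cycles n ⟶
    (P'.complex.linearYonedaObj R Y).X n => f z)
      (HomologicalComplex.cyclesMap_i (linearYonedaMap Y φ) n)

theorem extOfCocycle_cyclesMap (φ : Hom P' P g) (n : ℕ)
    (z : (P.complex.linearYonedaObj R Y).cycles n) :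
    P'.extOfCocycle Y n (HomologicalComplex.cyclesMap (linearYonedaMap Y φ) n z) =
      (Abelian.Ext.mk₀ g).comp (P.extOfCocycle Y n z) (zero_add n) := by
  rw [extOfCocycle_apply, extOfCocycle_apply, mk₀_comp_extMk _ _ _ _ φ]
  exact P'.extMk_congr (homOfCocycle_cyclesMap φ n z) _

/-- The functor `Ext` is a left derived functor of the opposite of Hom(-, Y), so this is naturality
of `isoLeftDerivedObj` read through `unop`, combined with homology of the opposite complex. -/
theorem isoExt_inv_naturality (φ : Hom P' P g) (n : ℕ) :
    (P.isoExt n Y).inv ≫ ((Ext R (ModuleCat.{u} R) n).map g.op).app Y =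
      HomologicalComplex.homologyMap (linearYonedaMap Y φ) n ≫ (P'.isoExt n Y).inv := by
  let F := ((linearYoneda R (ModuleCat.{u} R)).obj Y).rightOp
  have h1 := congrArg Quiver.Hom.unop (isoLeftDerivedObj_hom_naturality g P' P φ.hom
    φ.hom_f_zero_comp_π_f_zero F n)
  have h2 := congrArg Quiver.Hom.unop
    (HomologicalComplex.homologyOp_hom_naturality (linearYonedaMap Y φ) n)
  change (_ ≫ (P.isoLeftDerivedObj F n).hom.unop) ≫ ((F.leftDerived n).map g).unop =
    _ ≫ _ ≫ (P'.isoLeftDerivedObj F n).hom.unop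
  rw [Category.assoc]
  refine (congrArg (fun f => _ ≫ f) h1).trans ?_
  refine (Category.assoc _ _ _).symm.trans (Eq.trans ?_ (Category.assoc _ _ _))
  exact congrArg (fun f => f ≫ (P'.isoLeftDerivedObj F n).hom.unop) h2

theorem extFunctorOfCocycle_cyclesMap (φ : Hom P' P g) (n : ℕ)
    (z : (P.complex.linearYonedaObj R Y).cycles n) :
    P'.extFunctorOfCocycle Y n (HomologicalComplex.cyclesMap (linearYonedaMap Y φ) n z) =
      ((Ext R (ModuleCat.{u} R) n).map g.op).app Y (P.extFunctorOfCocycle Y n z) := by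
  have h : HomologicalComplex.cyclesMap (linearYonedaMap Y φ) n ≫
      (P'.complex.linearYonedaObj R Y).homologyπ n ≫ (P'.isoExt n Y).inv =
      ((P.complex.linearYonedaObj R Y).homologyπ n ≫ (P.isoExt n Y).inv) ≫
        ((Ext R (ModuleCat.{u} R) n).map g.op).app Y := by
    rw [Category.assoc, isoExt_inv_naturality φ, HomologicalComplex.homologyπ_naturality_assoc]
  exact congrArg (fun f => ModuleCat.Hom.hom f z) h

theorem extFunctorOfCocycle_surjective (n : ℕ) :
    Function.Surjective (P.extFunctorOfCocycle Y n) :=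
  (P.isoExt n Y).symm.toLinearEquiv.surjective.comp (HomologicalComplex.homologyπ_surjective _ n)

theorem extFunctorEquiv_map (φ : Hom P' P g) (n : ℕ)
    (x : ((Ext R (ModuleCat.{u} R) n).obj (Opposite.op X)).obj Y) :
    P'.extFunctorEquiv n (((Ext R (ModuleCat.{u} R) n).map g.op).app Y x) =
      (Abelian.Ext.mk₀ g).comp (P.extFunctorEquiv n x) (zero_add n) := by
  obtain ⟨z, rfl⟩ := P.extFunctorOfCocycle_surjective n x
  rw [← extFunctorOfCocycle_cyclesMap φ, extFunctorEquiv_apply, extFunctorEquiv_apply,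
    extOfCocycle_cyclesMap]

end CategoryTheory.ProjectiveResolution

/-! ### Identification with `localCohomology` -/

section LocalCohomology

open Opposite ProjectiveResolution

variable {R : Type u} [CommRing R] (I : Ideal R)

/-- The lift of a morphism to the chosen projective resolutions. -/
def projectiveResolutionHom {X X' : ModuleCat.{u} R} (g : X' ⟶ X) :
    ProjectiveResolution.Hom (projectiveResolution X') (projectiveResolution X) g where
  hom := ProjectiveResolution.lift g _ _
  hom_f_zero_comp_π_f_zero := by
    rw [ProjectiveResolution.lift_commutes_zero]
    rfl

/-- The cocone defining local cohomology, evaluated at a module. -/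
def localCohomologyCocone (M : ModuleCat.{u} R) (j : ℕ) :
    Limits.Cocone (localCohomology.diagram (localCohomology.idealPowersDiagram I) j ⋙
      (evaluation _ _).obj M) :=
  ((evaluation _ _).obj M).mapCocone (Limits.colimit.cocone _)

/-- The cocone defining local cohomology is a colimit. -/
def localCohomologyIsColimit (M : ModuleCat.{u} R) (j : ℕ) :
    Limits.IsColimit (localCohomologyCocone I M j) :=
  Limits.isColimitOfPreserves _ (Limits.colimit.isColimit _)

theorem localCohomologyCocone_exists_rep (M : ModuleCat.{u} R) (j : ℕ)
    (y : (localCohomology I j).obj M) :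
    ∃ (n : ℕ) (x : ((Ext R (ModuleCat.{u} R) j).obj (op (quotPow I n))).obj M),
      ((localCohomologyCocone I M j).ι.app (op (op n))).hom x = y := by
  -- The diagram is indexed by ℕ in universe 0, while the modules live in universe u.
  have : Limits.PreservesFilteredColimitsOfSize.{0, 0} (forget (ModuleCat.{u} R)) :=
    Limits.preservesFilteredColimitsOfSize_shrink.{0, u, 0, u} _
  obtain ⟨n, x, hx⟩ := Limits.Concrete.isColimit_exists_rep _ (localCohomologyIsColimit I M j) y
  exact ⟨n.unop.unop, x, hx⟩

theorem localCohomologyCocone_exists_map_eq_zero (M : ModuleCat.{u} R) (j n : ℕ)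
    (x : ((Ext R (ModuleCat.{u} R) j).obj (op (quotPow I n))).obj M)
    (hx : ((localCohomologyCocone I M j).ι.app (op (op n))).hom x = 0) :
    ∃ (n' : ℕ) (h : n ≤ n'),
      ((Ext R (ModuleCat.{u} R) j).map (quotPowMap I h).op).app M x = 0 := by
  have : Limits.PreservesFilteredColimitsOfSize.{0, 0} (forget (ModuleCat.{u} R)) :=
    Limits.preservesFilteredColimitsOfSize_shrink.{0, u, 0, u} _
  obtain ⟨n', f, f', hf⟩ := Limits.Concrete.isColimit_exists_of_rep_eq _
    (localCohomologyIsColimit I M j) (i := op (op n)) (j := op (op n)) x 0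
    (hx.trans (map_zero _).symm)
  exact ⟨n'.unop.unop, leOfHom f.unop.unop, hf.trans (map_zero _)⟩

/-- Local cohomology is the colimit of the groups of extensions. -/
def localCohomologyExtColimit (M : ModuleCat.{u} R) (j : ℕ) :
    ExtColimit I M j ((localCohomology I j).obj M) where
  ι n := ((localCohomologyCocone I M j).ι.app (op (op n))).hom ∘ₗ
    ((projectiveResolution (quotPow I n)).extFunctorEquiv j).symm.toLinearMap
  ι_restrict {n n'} h x := by
    obtain ⟨y, rfl⟩ := ((projectiveResolution (quotPow I n)).extFunctorEquiv j).surjective x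
    rw [extRestrict_apply, ← extFunctorEquiv_map (projectiveResolutionHom (quotPowMap I h))]
    refine (congrArg _ (LinearEquiv.symm_apply_apply _ _)).trans
      (Eq.trans ?_ (congrArg _ (LinearEquiv.symm_apply_apply _ _)).symm)
    exact congrArg (fun f => ModuleCat.Hom.hom f y)
      ((localCohomologyCocone I M j).w (homOfLE h).op.op)
  exists_ι_eq y := by
    obtain ⟨n, x, rfl⟩ := localCohomologyCocone_exists_rep I M j y
    exact ⟨n, (projectiveResolution (quotPow I n)).extFunctorEquiv j x,
      congrArg _ (LinearEquiv.symm_apply_apply _ _)⟩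
  exists_restrict_eq_zero n x hx := by
    obtain ⟨y, rfl⟩ := ((projectiveResolution (quotPow I n)).extFunctorEquiv j).surjective x
    obtain ⟨n', h, hy⟩ := localCohomologyCocone_exists_map_eq_zero I M j n y
      ((congrArg _ (LinearEquiv.symm_apply_apply _ _)).symm.trans hx)
    refine ⟨n', h, ?_⟩
    rw [extRestrict_apply, ← extFunctorEquiv_map (projectiveResolutionHom (quotPowMap I h)),
      hy, map_zero]

end LocalCohomology

/-! ### Vector spaces over the residue field -/

section ResidueField

variable {R : Type u} [CommRing R] [IsLocalRing R]

/-- A module killed by the maximal ideal, as a vector space over the residue field. -/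
@[reducible]
def moduleResidueField {V : Type*} [AddCommGroup V] [Module R V]
    (hV : Module.IsTorsionBySet R V (maximalIdeal R : Set R)) : Module (ResidueField R) V :=
  hV.module

theorem isScalarTower_residueField {V : Type*} [AddCommGroup V] [Module R V]
    (hV : Module.IsTorsionBySet R V (maximalIdeal R : Set R)) :
    letI := moduleResidueField hV
    IsScalarTower R (ResidueField R) V :=
  Module.IsTorsionBySet.isScalarTower (S := R) hV

theorem surjective_algebraMap_residueField :
    Function.Surjective (algebraMap R (ResidueField R)) :=
  residue_surjective

/-- R → k is surjective, so lengths over R and k agree. The value is a natural number because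
`Cardinal.toENat` separates only finite cardinals. -/
theorem rank_eq_of_length_eq {V : Type*} [AddCommGroup V] [Module R V]
    (hV : Module.IsTorsionBySet R V (maximalIdeal R : Set R)) {n : ℕ}
    (h : Module.length R V = n) :
    letI := moduleResidueField hV
    Module.rank (ResidueField R) V = n := by
  let _ := moduleResidueField hV
  have := isScalarTower_residueField hV
  rw [Module.length_eq_of_surjective (R := ResidueField R) surjective_algebraMap_residueField,
    Module.length_eq_rank] at h
  exact Cardinal.toENat_eq_natCast.1 h

theorem rank_eq_of_length_linearMap_eq {V : Type u} [AddCommGroup V] [Module R V]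
    (hV : Module.IsTorsionBySet R V (maximalIdeal R : Set R)) {n : ℕ}
    (h : Module.length R (V →ₗ[R] ResidueField R) = n) :
    letI := moduleResidueField hV
    Module.rank (ResidueField R) V = n := by
  let _ := moduleResidueField hV
  have := isScalarTower_residueField hV
  rw [(LinearMap.extendScalarsOfSurjectiveEquiv (S := ResidueField R) (M := V)
      surjective_algebraMap_residueField).length_eq,
    Module.length_eq_of_surjective (R := ResidueField R) surjective_algebraMap_residueField,
    Module.length_eq_rank] at h
  have h1 : Module.rank (ResidueField R) (Module.Dual (ResidueField R) V) = n :=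
    Cardinal.toENat_eq_natCast.1 h
  have h2 : Module.Finite (ResidueField R) (Module.Dual (ResidueField R) V) :=
    Module.rank_lt_aleph0_iff.1 (h1 ▸ Cardinal.natCast_lt_aleph0)
  have h3 := (Module.finite_dual_iff (ResidueField R)).1 h2
  rw [← Module.finrank_eq_rank, Subspace.dual_finrank_eq] at h1
  rw [← Module.finrank_eq_rank, h1]

/-- Functionals with values in the residue field extend along maps to modules killed by the maximal
ideal. -/
theorem exists_comp_eq_of_ker_le {B C : Type u} [AddCommGroup B] [Module R B] [AddCommGroup C]
    [Module R C] (hC : Module.IsTorsionBySet R C (maximalIdeal R : Set R)) (δ : B →ₗ[R] C)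
    (φ : B →ₗ[R] ResidueField R) (h : LinearMap.ker δ ≤ LinearMap.ker φ) :
    ∃ ψ : C →ₗ[R] ResidueField R, ψ ∘ₗ δ = φ := by
  let Q := B ⧸ LinearMap.ker δ
  let i : Q →ₗ[R] C := (LinearMap.ker δ).liftQ δ le_rfl
  have hi : Function.Injective i := LinearMap.ker_eq_bot.1 (Submodule.ker_liftQ_eq_bot' _ _ rfl)
  have hQ : Module.IsTorsionBySet R Q (maximalIdeal R : Set R) := fun q r => hi <| by
    rw [map_zero]
    exact (map_smul i (r : R) q).trans (hC (x := i q) (a := r))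
  let _ := moduleResidueField hC
  let _ := moduleResidueField hQ
  have := isScalarTower_residueField hC
  have := isScalarTower_residueField hQ
  -- Over the field k the embedding of B/ker δ into C splits.
  obtain ⟨g, hg⟩ := LinearMap.exists_leftInverse_of_injective
    (i.extendScalarsOfSurjective (S := ResidueField R) surjective_algebraMap_residueField)
    (LinearMap.ker_eq_bot.2 hi)
  refine ⟨(LinearMap.ker δ).liftQ φ h ∘ₗ g.restrictScalars R, LinearMap.ext fun b => ?_⟩
  have hb : g (δ b) = Submodule.Quotient.mk b := LinearMap.congr_fun hg (Submodule.Quotient.mk b)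
  change (LinearMap.ker δ).liftQ φ h (g (δ b)) = φ b
  rw [hb]
  rfl

variable (R) in
/-- A functional on `P` with values in `k` is a functional on `k ⊗ P`. -/
def residueFieldTensorHom (P : Type u) [AddCommGroup P] [Module R P] :
    (P →ₗ[R] ResidueField R) ≃ₗ[R] (TensorProduct R (ResidueField R) P →ₗ[R] ResidueField R) :=
  LinearEquiv.ofLinearMap
    { toFun := fun f => TensorProduct.lift ((LinearMap.mul R (ResidueField R)).compl₂ f)
      map_add' := fun f g => TensorProduct.ext' fun a b => mul_add a _ _
      map_smul' := fun r f => TensorProduct.ext' fun a b => mul_smul_comm r a _ }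
    (LinearMap.lcomp R (ResidueField R) (TensorProduct.mk R (ResidueField R) P 1))
    (LinearMap.ext fun ψ => TensorProduct.ext' fun a b => by
      obtain ⟨r, rfl⟩ := residue_surjective a
      change residue R r * ψ (1 ⊗ₜ b) = ψ (residue R r ⊗ₜ b)
      have h1 : residue R r = r • (1 : ResidueField R) := by
        rw [Algebra.smul_def, mul_one]
        rfl
      rw [h1, ← TensorProduct.smul_tmul', map_smul, smul_mul_assoc, one_mul])
    (LinearMap.ext fun f => LinearMap.ext fun b => one_mul (f b))

end ResidueField

/-! ### Duality between Ext^n(X, k) and Tor_n(k, X) -/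

namespace CategoryTheory.ProjectiveResolution

variable {R : Type u} [CommRing R] [IsLocalRing R] {X : ModuleCat.{u} R}
  (P : ProjectiveResolution X)

/-- The complex `k ⊗ P`. -/
abbrev residueFieldTensor : ChainComplex (ModuleCat.{u} R) ℕ :=
  (((MonoidalCategory.tensoringLeft (ModuleCat.{u} R)).obj
    (residueFieldObj R)).mapHomologicalComplex (ComplexShape.down ℕ)).obj P.complex

theorem isTorsionBySet_residueFieldTensor (n : ℕ) :
    Module.IsTorsionBySet R (P.residueFieldTensor.X n) (maximalIdeal R : Set R) := by
  rintro x ⟨r, hr⟩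
  refine TensorProduct.induction_on (motive := fun x : TensorProduct R (ResidueField R)
    (P.complex.X n) => r • x = 0) x (smul_zero r) (fun a b => ?_) fun a b ha hb => ?_
  · rw [TensorProduct.smul_tmul', smul_residueField_eq_zero R hr, TensorProduct.zero_tmul]
  · rw [smul_add, ha, hb, add_zero]

/-- The functional on `k ⊗ P_n` induced by a functional on `P_n`. -/
def tensorFunctional {n : ℕ} :
    (P.complex.X n ⟶ residueFieldObj R) ≃ₗ[R] (P.residueFieldTensor.X n →ₗ[R] ResidueField R) :=
  ModuleCat.homLinearEquiv.trans (residueFieldTensorHom R (P.complex.X n))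

theorem tensorFunctional_d_comp {m n : ℕ} (f : P.complex.X n ⟶ residueFieldObj R) :
    P.tensorFunctional (P.complex.d m n ≫ f) =
      P.tensorFunctional f ∘ₗ (P.residueFieldTensor.d m n).hom :=
  TensorProduct.ext' fun _ _ => rfl

/-- The restriction of a cocycle to the cycles of `k ⊗ P`. -/
def cocycleToCycles (n : ℕ) :
    (P.complex.linearYonedaObj R (residueFieldObj R)).cycles n →ₗ[R]
      (P.residueFieldTensor.cycles n →ₗ[R] ResidueField R) :=
  LinearMap.lcomp R _ (P.residueFieldTensor.iCycles n).hom ∘ₗ P.tensorFunctional.toLinearMap ∘ₗ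
    ((P.complex.linearYonedaObj R (residueFieldObj R)).iCycles n).hom

theorem cocycleToCycles_apply {n : ℕ}
    (z : (P.complex.linearYonedaObj R (residueFieldObj R)).cycles n) :
    P.cocycleToCycles n z =
      P.tensorFunctional (P.homOfCocycle z) ∘ₗ (P.residueFieldTensor.iCycles n).hom := rfl

/-- A functional on k ⊗ P_n vanishing on cycles factors through the differential and extends to the
next term over k; hence the cocycle is a coboundary. -/
theorem ker_cocycleToCycles (n : ℕ) :
    LinearMap.ker (P.extOfCocycle (residueFieldObj R) n) = LinearMap.ker (P.cocycleToCycles n) := by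
  ext z
  rw [LinearMap.mem_ker, LinearMap.mem_ker, cocycleToCycles_apply, extOfCocycle_apply,
    extMk_eq_zero_iff_next]
  constructor
  · rintro ⟨g, hg⟩
    rw [← hg, tensorFunctional_d_comp, LinearMap.comp_assoc]
    refine LinearMap.ext fun c => ?_
    exact (congrArg _ (P.residueFieldTensor.d_iCycles_apply n _ c)).trans (map_zero _)
  · intro h
    obtain ⟨ψ, hψ⟩ := exists_comp_eq_of_ker_le (P.isTorsionBySet_residueFieldTensor _)
      (P.residueFieldTensor.d n ((ComplexShape.up ℕ).prev n)).hom
      (P.tensorFunctional (P.homOfCocycle z)) fun x hx => by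
        obtain ⟨c, rfl⟩ := P.residueFieldTensor.exists_iCycles_eq rfl x hx
        exact LinearMap.congr_fun h c
    refine ⟨P.tensorFunctional.symm ψ, P.tensorFunctional.injective ?_⟩
    rw [tensorFunctional_d_comp, LinearEquiv.apply_symm_apply, hψ]

/-- Cocycles kill boundaries, so they descend to homology. Conversely a functional on homology,
pulled back to cycles, extends to k ⊗ P_n over k and gives a cocycle since it kills boundaries. -/
theorem range_cocycleToCycles (n : ℕ) :
    LinearMap.range (P.cocycleToCycles n) =
      LinearMap.range (LinearMap.lcomp R (ResidueField R)
        (P.residueFieldTensor.homologyπ n).hom) := by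
  have hprev : (ComplexShape.down ℕ).prev n = n + 1 := by simp
  ext φ
  constructor
  · rintro ⟨z, rfl⟩
    have hker : LinearMap.ker (P.residueFieldTensor.homologyπ n).hom ≤
        LinearMap.ker (P.cocycleToCycles n z) := by
      intro c hc
      obtain ⟨w, hw⟩ := (P.residueFieldTensor.homologyπ_eq_zero_iff hprev c).1 hc
      refine (congrArg (P.tensorFunctional (P.homOfCocycle z)) hw.symm).trans ?_
      refine (LinearMap.congr_fun (P.tensorFunctional_d_comp (P.homOfCocycle z)) w).symm.trans ?_
      rw [d_homOfCocycle, map_zero, LinearMap.zero_apply]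
    refine ⟨(LinearMap.ker _).liftQ _ hker ∘ₗ (LinearMap.quotKerEquivOfSurjective _
      (P.residueFieldTensor.homologyπ_surjective n)).symm.toLinearMap, LinearMap.ext fun c => ?_⟩
    have h1 : (LinearMap.quotKerEquivOfSurjective _
        (P.residueFieldTensor.homologyπ_surjective n)).symm (P.residueFieldTensor.homologyπ n c) =
        Submodule.Quotient.mk c := (LinearEquiv.symm_apply_eq _).2 rfl
    exact (congrArg _ h1).trans rfl
  · rintro ⟨g, rfl⟩
    obtain ⟨ψ, hψ⟩ := exists_comp_eq_of_ker_le (P.isTorsionBySet_residueFieldTensor _)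
      (P.residueFieldTensor.iCycles n).hom
      (g ∘ₗ (P.residueFieldTensor.homologyπ n).hom) fun x hx => by
        have hx0 : x = 0 := P.residueFieldTensor.iCycles_injective n (hx.trans (map_zero _).symm)
        rw [hx0]
        exact Submodule.zero_mem _
    obtain ⟨z, hz⟩ := P.exists_homOfCocycle_eq (P.tensorFunctional.symm ψ) <| by
      refine P.tensorFunctional.injective ?_
      rw [tensorFunctional_d_comp, LinearEquiv.apply_symm_apply, map_zero]
      refine LinearMap.ext fun w => ?_
      have h1 : P.residueFieldTensor.d (n + 1) n w =
          P.residueFieldTensor.iCycles n (P.residueFieldTensor.toCycles (n + 1) n w) :=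
        (congrArg (fun f => ModuleCat.Hom.hom f w)
          (P.residueFieldTensor.toCycles_i (n + 1) n)).symm
      refine (congrArg ψ h1).trans ((LinearMap.congr_fun hψ _).trans ?_)
      refine (congrArg g ((P.residueFieldTensor.homologyπ_eq_zero_iff hprev _).2 ⟨w, h1⟩)).trans
        (map_zero g)
    refine ⟨z, ?_⟩
    rw [cocycleToCycles_apply, hz, LinearEquiv.apply_symm_apply, hψ]
    rfl

/-- The group `Ext^n(X, k)` is dual to the homology of `k ⊗ P`. -/
def extResidueFieldEquiv (n : ℕ) : Abelian.Ext.{u} X (residueFieldObj R) n ≃ₗ[R]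
    (P.residueFieldTensor.homology n →ₗ[R] ResidueField R) :=
  let e : Abelian.Ext.{u} X (residueFieldObj R) n ≃ₗ[R] LinearMap.range (P.cocycleToCycles n) :=
    LinearMap.equivOfKerEq (C := LinearMap.range (P.cocycleToCycles n))
      (P.extOfCocycle (residueFieldObj R) n)
      (P.cocycleToCycles n).rangeRestrict (P.extOfCocycle_surjective n)
      (LinearMap.surjective_rangeRestrict _)
      ((P.ker_cocycleToCycles n).trans (LinearMap.ker_rangeRestrict _).symm)
  e.trans <| (LinearEquiv.ofEq _ _ (P.range_cocycleToCycles n)).trans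
    (LinearEquiv.ofInjective _ fun _ _ h => (LinearMap.cancel_right
      (P.residueFieldTensor.homologyπ_surjective n)).1 h).symm

end CategoryTheory.ProjectiveResolution

/-! ### Betti and Bass numbers as lengths -/

section BettiNumbers

variable {R : Type u} [CommRing R] [IsLocalRing R]

theorem bettiNumber_eq_of_length_eq (N : Type u) [AddCommGroup N] [Module R N] (i : ℕ) {n : ℕ}
    (h : Module.length R (Abelian.Ext.{u} (ModuleCat.of R N) (residueFieldObj R) i) = n) :
    bettiNumber R N i = n := by
  refine rank_eq_of_length_linearMap_eq (torResidueField_isTorsionBySet R N i) (h ▸ ?_)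
  let P := projectiveResolution (ModuleCat.of R N)
  let e : torResidueField R N i ≅ P.residueFieldTensor.homology i := P.isoLeftDerivedObj _ i
  exact (LinearEquiv.congrLeft (ResidueField R) R e.toLinearEquiv).length_eq.trans
    (P.extResidueFieldEquiv i).length_eq.symm

theorem bassNumber_eq_of_length_eq (N : ModuleCat.{u} R) (i : ℕ) {n : ℕ}
    (h : Module.length R (Abelian.Ext.{u} (residueFieldObj R) N i) = n) :
    bassNumber R N i = n :=
  rank_eq_of_length_eq (extResidueField_isTorsionBySet R N i) h

theorem length_eq_of_bassNumber_eq {N : ModuleCat.{u} R} {i n : ℕ} (h : bassNumber R N i = n) :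
    Module.length R (Abelian.Ext.{u} (residueFieldObj R) N i) = n := by
  let _ := extResidueFieldModule R N i
  have := isScalarTower_residueField (extResidueField_isTorsionBySet R N i)
  rw [Module.length_eq_of_surjective (R := ResidueField R) surjective_algebraMap_residueField,
    Module.length_eq_rank]
  exact Cardinal.toENat_eq_natCast.2 h

end BettiNumbers

/-! ### Depth and vanishing of Ext -/

section Depth

variable {R : Type u} [CommRing R] [IsLocalRing R]

theorem exists_isRegular_of_lt_moduleDepth {M : Type u} [AddCommGroup M] [Module R M] {j : ℕ}
    (h : (j : ℕ∞) < moduleDepth R M) :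
    ∃ rs : List R, RingTheory.Sequence.IsRegular M rs ∧ (∀ r ∈ rs, r ∈ maximalIdeal R) ∧
      j < rs.length := by
  obtain ⟨rs, hrs⟩ := lt_iSup_iff.1 h
  obtain ⟨⟨h1, h2⟩, h3⟩ := lt_iSup_iff.1 hrs
  exact ⟨rs, h1, h2, Nat.cast_lt.1 h3⟩

theorem length_le_moduleDepth {M : Type u} [AddCommGroup M] [Module R M] {rs : List R}
    (h : RingTheory.Sequence.IsRegular M rs) (hrs : ∀ r ∈ rs, r ∈ maximalIdeal R) :
    (rs.length : ℕ∞) ≤ moduleDepth R M :=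
  le_iSup₂_of_le (f := fun (rs : List R) (_ : RingTheory.Sequence.IsRegular M rs ∧
    ∀ r ∈ rs, r ∈ maximalIdeal R) => (rs.length : ℕ∞)) rs ⟨h, hrs⟩ le_rfl

/-- A finite supremum in `ℕ∞` is attained; for d = 0 the empty sequence is regular because M is
nontrivial. -/
theorem exists_isRegular_length_eq_moduleDepth {M : Type u} [AddCommGroup M] [Module R M]
    [Nontrivial M] {d : ℕ} (h : moduleDepth R M = d) :
    ∃ rs : List R, RingTheory.Sequence.IsRegular M rs ∧ (∀ r ∈ rs, r ∈ maximalIdeal R) ∧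
      rs.length = d := by
  obtain _ | d := d
  · exact ⟨[], RingTheory.Sequence.IsRegular.nil R M, by simp, rfl⟩
  · obtain ⟨rs, h1, h2, h3⟩ := exists_isRegular_of_lt_moduleDepth (M := M) (j := d)
      (h ▸ Nat.cast_lt.2 (Nat.lt_succ_self d))
    refine ⟨rs, h1, h2, le_antisymm ?_ h3⟩
    exact Nat.cast_le.1 ((length_le_moduleDepth h1 h2).trans h.le)

/-- Rees's criterion applied to a regular sequence longer than j, with Nakayama supplying 𝔪M ≠ M. -/
theorem subsingleton_ext_of_lt_moduleDepth [IsNoetherianRing R] {M : Type u} [AddCommGroup M]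
    [Module R M] [Module.Finite R M] {j : ℕ} (h : (j : ℕ∞) < moduleDepth R M) :
    Subsingleton (Abelian.Ext.{u} (residueFieldObj R) (ModuleCat.of R M) j) := by
  obtain ⟨rs, h1, h2, h3⟩ := exists_isRegular_of_lt_moduleDepth h
  have : Nontrivial M := h1.nontrivial
  refine ModuleCat.subsingleton_ext_of_exists_isRegular (maximalIdeal R) (residueFieldObj R) ?_
    (ModuleCat.of R M) ?_ rs h2 h1 j h3
  · rw [Module.support_eq_zeroLocus]
    refine PrimeSpectrum.zeroLocus_anti_mono fun r hr => ?_
    exact Module.mem_annihilator.2 (smul_residueField_eq_zero R hr)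
  · refine lt_top_iff_ne_top.2 fun h => ?_
    exact top_ne_bot (Submodule.eq_bot_of_le_smul_of_le_jacobson_bot (maximalIdeal R)
      (⊤ : Submodule R M) Module.Finite.fg_top h.ge (maximalIdeal_le_jacobson _))

end Depth

/-! ### The main theorem -/

theorem mainTheorem5 (R : Type u) [CommRing R] [IsLocalRing R] [IsNoetherianRing R]
    [IsAdicComplete (maximalIdeal R) R] (hR : IsCohenMacaulayLocal R)
    (d : ℕ) (hd : ringKrullDim R = d)
    (ω : Type u) [AddCommGroup ω] [Module R ω] (hω : IsCanonicalModule R ω) (i : ℕ) :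
    bettiNumber R ω i = ∑ j ∈ Finset.range (d + 1), lyubeznikNumber R i j := by
  have := hω.finite
  have hRd : moduleDepth R R = d := WithBot.coe_injective (hR.trans hd)
  have hωd : moduleDepth R ω = d := WithBot.coe_injective (hω.depth_eq.trans hd)
  have hR0 : ∀ j < d, Subsingleton (Abelian.Ext.{u} (residueFieldObj R) (ModuleCat.of R R) j) :=
    fun j hj => subsingleton_ext_of_lt_moduleDepth (hRd ▸ Nat.cast_lt.2 hj)
  have hω0 : ∀ j < d, Subsingleton (Abelian.Ext.{u} (residueFieldObj R) (ModuleCat.of R ω) j) :=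
    fun j hj => subsingleton_ext_of_lt_moduleDepth (hωd ▸ Nat.cast_lt.2 hj)
  have hdim : Module.supportDim R R ≤ d := by
    rw [Module.supportDim_self_eq_ringKrullDim, hd]
  obtain ⟨rs, hreg, hrs, hlen⟩ := exists_isRegular_length_eq_moduleDepth hRd
  obtain ⟨n, hn⟩ := hω.finite_injectiveDimension
  have hω1 : Subsingleton (Abelian.Ext.{u} (residueFieldObj R) (ModuleCat.of R ω) (d + 1)) :=
    subsingleton_ext_of_hasInjectiveDimensionLE (n := n) hreg hrs (by rw [hd, hlen]) _ (by lia)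
  have htype : Module.length R
      (Abelian.Ext.{u} (residueFieldObj R) (ModuleCat.of R ω) d) = 1 := by
    have h := hω.type_eq_one
    rw [moduleType, hωd, ENat.toNat_natCast] at h
    exact_mod_cast length_eq_of_bassNumber_eq (n := 1) (by exact_mod_cast h)
  have key : Module.length R (Abelian.Ext.{u} (residueFieldObj R)
        ((localCohomology (maximalIdeal R) d).obj (ModuleCat.of R R)) i) =
      Module.length R (Abelian.Ext.{u} (ModuleCat.of R ω) (residueFieldObj R) i) :=
    (length_ext_eq_of_extColimit (localCohomologyExtColimit (maximalIdeal R) (ModuleCat.of R R) d)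
      hR0 (fun j hj => ExtEventuallyZero.of_supportDim_le R hR0 hdim j hj) i).trans
    -- With π the identity the annihilating ideal is zero, so the length condition is asked of all
    -- finite length modules.
    (length_ext_add_eq d R ω LinearMap.id Function.surjective_id
      (by rw [LinearMap.ker_id]; exact bot_le)
      (by rw [LinearMap.ker_id]; rintro r rfl y; exact zero_smul R y) hR0 hω0 hdim
      (fun X _ _ hX _ => length_ext_of_isFiniteLength
        (fun j hj => hω0 j (by lia)) hω1 htype hX) i)
  -- The common length is finite, so it determines both cardinal dimensions; the terms with j < d
  -- vanish because `H^j_𝔪(R) = 0`.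
  obtain ⟨b, hb⟩ := ENat.ne_top_iff_exists.1 (length_ext_residueField_ne_top (R := R) ω i)
  rw [bettiNumber_eq_of_length_eq ω i hb.symm, Finset.sum_range_succ, Finset.sum_eq_zero, zero_add,
    lyubeznikNumber, bassNumber_eq_of_length_eq _ i (key.trans hb.symm)]
  intro j hj
  have hj0 : Subsingleton ((localCohomology (maximalIdeal R) j).obj (ModuleCat.of R R)) :=
    (localCohomologyExtColimit (maximalIdeal R) (ModuleCat.of R R) j).subsingleton
      (subsingleton_ext_quotPow (hR0 j (Finset.mem_range.1 hj)))
  have hj1 := Abelian.Ext.subsingleton_of_isZero_right (X := residueFieldObj R)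
    (Y := (localCohomology (maximalIdeal R) j).obj (ModuleCat.of R R)) i
  refine (bassNumber_eq_of_length_eq _ i (n := 0) ?_).trans Nat.cast_zero
  exact Module.length_eq_zero_iff.2 hj1

end
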